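/- Fix $\lambda_b,\lambda_u,P_b>0$, $\alpha>2$, $\sigma_n^2\ge 0$, and $c=7/2$. Base stations form a homogeneous Poisson point process $\Phi_b$ of intensity $\lambda_b$ on $\mathbb{R}^2$. A tagged user at the origin $o$ is served by the nearest base station $b_o$, at distance $R$. The number $N$ of other users in its cell has probability mass function $$f_N(n)=\frac{\Gamma(n+c+1)\,\bigl(\lambda_u/(c\lambda_b)\bigr)^n}{\Gamma(n+1)\,\Gamma(c+1)\,\bigl(\lambda_u/(c\lambda_b)+1\bigr)^{n+c+1}},\qquad n=0,1,2,\dots$$ The users of the cell have fading gains $h_1,\dots,h_{N+1}$ ($h_1$ being the gain of the tagged user) and arbitrary positive random distances to $b_o$ (the tagged user's being $R$); the link from an interfering base station $b$ to the tagged user has gain $g_b$. All gains are i.i.d. exponential with mean $1$, and $\Phi_b$, the family $(g_b)$, the family $(h_i)$ and $N$ are mutually independent (the approximation that $N$ is independent of the geometry). All base stations transmit. Let $I=P_b\sum_{b\in\Phi_b\setminus\{b_o\}}g_b|b|^{-\alpha}$. A user with gain $h$ at distance $r$ has instantaneous SNR $P_b h r^{-\alpha}/\sigma_n^2$ (the common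 factor $1/\sigma_n^2$ is dropped if $\sigma_n^2=0$). The scheduler selects the user of the cell with the largest SNR normalized by its mean over the fading. Let $h_{n+1:n+1}=\max_{1\le i\le n+1}h_i$, let $$\mathit{SINR}=\frac{P_b\,h_{N+1:N+1}\,R^{-\alpha}}{\sigma_n^2+I},$$ and let $\tau_s=\mathbb{E}[\ln(1+\mathit{SINR})]$ be the average data rate of normalized SNR scheduling. Then the series $I$ converges almost surely, $\ln(1+\mathit{SINR})$ is integrable, and $$\tau_s=\pi\lambda_b\sum_{n=0}^\infty f_N(n)\int_0^\infty\!\!\int_0^\infty\sum_{k=1}^{n+1}\binom{n+1}{k}(-1)^{k+1}\exp\!\Bigl(-\pi\lambda_b v\bigl(1+\rho(k(e^t-1),\alpha)\bigr)-\frac{k v^{\alpha/2}(e^t-1)\sigma_n^2}{P_b}\Bigr)\,dt\,dv,$$ where $$\rho(\theta,\alpha)=\theta^{2/\alpha}\int_{\theta^{-2/\alpha}}^\infty\frac{du}{1+u^{\alpha/2}},$$ each double integral converging absolutely and the series over $n$ converging. Moreover, $\tau_s$ is the rate of the tagged user when it is scheduled: for each $n$ the event that $N=n$ and the tagged user is scheduled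 has positive probability, the rate $\ln\bigl(1+P_b h_1R^{-\alpha}/(\sigma_n^2+I)\bigr)$ is integrable given this event, and $$\tau_s=\sum_{n=0}^\infty f_N(n)\,\mathbb{E}\Bigl[\ln\Bigl(1+\frac{P_b h_1R^{-\alpha}}{\sigma_n^2+I}\Bigr)\Bigm|N=n,\ \text{the tagged user is scheduled}\Bigr].$$ -/

import Mathlib

open MeasureTheory ProbabilityTheory Set
open scoped ENNReal NNReal

noncomputable section

namespace Cellular

/-- The Euclidean plane. -/
abbrev Plane : Type := EuclideanSpace ℝ (Fin 2)

section Points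

variable {Ω : Type*} [MeasurableSpace Ω]

/-- Number of points of the random configuration `X 0, X 1, …` that lie in `A`. -/
def pointCount (X : ℕ → Ω → Plane) (A : Set Plane) (ω : Ω) : ℕ∞ :=
  {i : ℕ | X i ω ∈ A}.encard

/-- The points `X 0, X 1, …` (an arbitrary measurable enumeration) form a homogeneous Poisson
point process of intensity `lam` on the plane: the number of points in a Borel set `A` of finite
area is Poisson with mean `lam * area A`, and the numbers of points in pairwise disjoint such sets
are independent. -/
structure IsHomogeneousPPP (μ : Measure Ω) (lam : ℝ) (X : ℕ → Ω → Plane) : Prop where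
  measurable : ∀ i, Measurable (X i)
  count_law : ∀ A : Set Plane, MeasurableSet A → volume A ≠ ∞ → ∀ n : ℕ,
    μ {ω | pointCount X A ω = n} = poissonMeasure (lam * volume.real A).toNNReal {n}
  count_indep : ∀ (m : ℕ) (A : Fin m → Set Plane), (∀ j, MeasurableSet (A j)) →
    (∀ j, volume (A j) ≠ ∞) → Pairwise (fun i j => Disjoint (A i) (A j)) →
    iIndepFun (fun j => pointCount X (A j)) μ

/-- A sequence of independent exponential random variables with unit mean (Rayleigh fading). -/
structure IsIIDExp (μ : Measure Ω) (g : ℕ → Ω → ℝ) : Prop where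
  measurable : ∀ i, Measurable (g i)
  law : ∀ i, μ.map (g i) = expMeasure 1
  indep : iIndepFun g μ

end Points

/-- The constant `c = 7/2`. -/
def cVor : ℝ := 7 / 2

/-- The probability mass function `f_N` of the number of other users in the cell. -/
def pmfN (lamb lamu : ℝ) (n : ℕ) : ℝ :=
  Real.Gamma (n + cVor + 1) * (lamu / (cVor * lamb)) ^ n /
    (Real.Gamma (n + 1) * Real.Gamma (cVor + 1) *
      (lamu / (cVor * lamb) + 1) ^ ((n : ℝ) + cVor + 1))

/-- Index of the base station nearest to the origin (the location of the tagged user). -/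
def nearestBS (x : ℕ → Plane) : ℕ := sInf {i | ∀ j, ‖x i‖ ≤ ‖x j‖}

/-- Distance from the tagged user to its associated base station. -/
def servingDist (x : ℕ → Plane) : ℝ := ‖x (nearestBS x)‖

/-- Fading gain times path loss of the link from the `i`-th base station to the tagged user, for
the interfering base stations; the associated base station contributes `0`. -/
def interfererTerm (α : ℝ) (x : ℕ → Plane) (g : ℕ → ℝ) (i : ℕ) : ℝ :=
  if i = nearestBS x then 0 else g i * ‖x i‖ ^ (-α)

/-- Aggregate interference at the tagged user from all other base stations. -/
def interference (P α : ℝ) (x : ℕ → Plane) (g : ℕ → ℝ) : ℝ :=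
  P * ∑' i, interfererTerm α x g i

/-- SINR of the tagged user when the fading gain of its desired signal is `gain`. -/
def sinr (P α σ2 : ℝ) (x : ℕ → Plane) (g : ℕ → ℝ) (gain : ℝ) : ℝ :=
  P * gain * servingDist x ^ (-α) / (σ2 + interference P α x g)

/-- Largest order statistic `h_{n+1:n+1}` of the gains `h 0, …, h n`. -/
def maxGain (h : ℕ → ℝ) (n : ℕ) : ℝ :=
  (Finset.range (n + 1)).sup' Finset.nonempty_range_add_one h

/-- Instantaneous SNR with fading gain `x` at distance `r` from the serving base station.
The noise power is a common factor of all SNRs that are compared; in the noiseless case `σ2 = 0`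
it is dropped. -/
def snr (P α σ2 x r : ℝ) : ℝ :=
  P * x * r ^ (-α) / (if σ2 = 0 then 1 else σ2)

/-- Short-term average SNR at distance `r`: the mean over the unit-mean exponential fading. -/
def avgSNR (P α σ2 r : ℝ) : ℝ := ∫ x, snr P α σ2 x r ∂(expMeasure 1)

/-- Instantaneous SNR normalized by the short-term average SNR. -/
def normSNR (P α σ2 x r : ℝ) : ℝ := snr P α σ2 x r / avgSNR P α σ2 r

/-- With `n` other users in the cell, the scheduler selects user `0` (the tagged user): its
normalized SNR is the largest. `h i` and `r i` are the fading gain of user `i` and its distance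
from the serving base station. -/
def TaggedScheduled (P α σ2 : ℝ) (h r : ℕ → ℝ) (n : ℕ) : Prop :=
  ∀ i ∈ Finset.range (n + 1), normSNR P α σ2 (h i) (r i) ≤ normSNR P α σ2 (h 0) (r 0)

/-- The downlink model. `X`: base stations; `g i`: fading gain from base station `i` to the
tagged user; `N`: number of other users in the cell of the tagged user; `h i`, `r i`: fading
gain of user `i` of the cell and its distance to the serving base station, user `0` being the
tagged user at the origin (only users `0, …, N` are present). The count `N` is independent of the
base stations and of all fading gains. -/
structure IsDownlinkModel {Ω : Type*} [MeasurableSpace Ω] (μ : Measure Ω) (lamb lamu : ℝ)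
    (X : ℕ → Ω → Plane) (g h r : ℕ → Ω → ℝ) (N : Ω → ℕ) : Prop where
  ppp : IsHomogeneousPPP μ lamb X
  fading_interf : IsIIDExp μ g
  fading_users : IsIIDExp μ h
  measurable_N : Measurable N
  law_N : ∀ n, μ.real {ω | N ω = n} = pmfN lamb lamu n
  measurable_r : ∀ i, Measurable (r i)
  r_pos : ∀ i, ∀ᵐ ω ∂μ, 0 < r i ω
  r_tagged : ∀ ω, r 0 ω = servingDist (fun j => X j ω)
  indep_interf : IndepFun (fun ω i => X i ω) (fun ω i => g i ω) μ
  indep_users : IndepFun (fun ω => ((fun i => X i ω), (fun i => g i ω)))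
    (fun ω i => h i ω) μ
  indep_N : IndepFun (fun ω => ((fun i => X i ω), (fun i => g i ω), (fun i => h i ω))) N μ

/-- Rate `ln (1 + SINR)` with the desired-signal gain `h_{N+1:N+1}`. -/
def scheduledRate {Ω : Type*} (P α σ2 : ℝ) (X : ℕ → Ω → Plane) (g h : ℕ → Ω → ℝ) (N : Ω → ℕ)
    (ω : Ω) : ℝ :=
  Real.log (1 + sinr P α σ2 (fun i => X i ω) (fun i => g i ω)
    (maxGain (fun i => h i ω) (N ω)))

/-- Rate `ln (1 + SINR)` with the tagged user's own gain `h 0`. -/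
def taggedRate {Ω : Type*} (P α σ2 : ℝ) (X : ℕ → Ω → Plane) (g h : ℕ → Ω → ℝ) (ω : Ω) : ℝ :=
  Real.log (1 + sinr P α σ2 (fun i => X i ω) (fun i => g i ω) (h 0 ω))

/-- Average data rate `τ_s = E[ln (1 + SINR)]` of normalized SNR scheduling. -/
def avgRate {Ω : Type*} [MeasurableSpace Ω] (μ : Measure Ω) (P α σ2 : ℝ)
    (X : ℕ → Ω → Plane) (g h : ℕ → Ω → ℝ) (N : Ω → ℕ) : ℝ :=
  ∫ ω, scheduledRate P α σ2 X g h N ω ∂μ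

/-- The event that there are `n` other users in the cell and the tagged user is scheduled. -/
def scheduledEvent {Ω : Type*} (P α σ2 : ℝ) (h r : ℕ → Ω → ℝ) (N : Ω → ℕ) (n : ℕ) : Set Ω :=
  {ω | N ω = n ∧ TaggedScheduled P α σ2 (fun i => h i ω) (fun i => r i ω) n}

/-- `ρ(θ, α) = θ^{2/α} ∫_{θ^{-2/α}}^∞ du / (1 + u^{α/2})`. -/
def rho (θ α : ℝ) : ℝ :=
  θ ^ (2 / α) * ∫ u in Ioi (θ ^ (-(2 / α))), 1 / (1 + u ^ (α / 2))

/-- The alternating binomial sum under the double integral over `v` and `t`. -/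
def rateIntegrand (lamb P α σ2 : ℝ) (n : ℕ) (v t : ℝ) : ℝ :=
  ∑ k ∈ Finset.Icc 1 (n + 1), ((n + 1).choose k : ℝ) * (-1) ^ (k + 1) *
    Real.exp (-(Real.pi * lamb * v * (1 + rho (k * (Real.exp t - 1)) α))
      - k * v ^ (α / 2) * (Real.exp t - 1) * σ2 / P)

end Cellular

end

/-! Put `W = R^α (σ² + I) / P` (`invSinr`). Every SINR is a fading gain divided by `W`; moreover `W`
is independent of the user gains, and the pair is independent of `N`. So the whole theorem rests on
the Laplace transform of `W`.

Laplace transform. Poisson counts on disjoint sets give the Laplace functional of the process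
(`IsHomogeneousPPP.laplace`), and averaging exponential marks replaces a weight `φ` by `ln (1 + φ)`
(`IsHomogeneousPPP.laplace_marked`). Values live in `[0, ∞]` with `exp (-∞) = 0`: weight `∞` on a
disc restricts the functional to the event that the disc is empty. Conditioning on `R` is avoided.
The axis of squared distances is cut into cells, the event that the nearest point falls in a cell is
a difference of two void events, and the mesh tends to 0 (`IsHomogeneousPPP.lintegral_invSnr`). A
scaling substitution produces `ρ` (`lintegral_lossBeyond_eq_rho`), so that `E[exp (-θ W)]` is an
explicit integral over `v = R²`.

Rate. For the maximum `M` of `n + 1` gains, `E[ln (1 + M / W)]` is the integral over `t > 0` of `P(M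
> W (e^t - 1))`. The tail `1 - (1 - e^{-y})^{n+1}` expands into exponentials `e^{-k y}`, whose means
are values of the Laplace transform at `θ = k (e^t - 1)` (`IsIIDExp.lintegral_log_maxGain_eq`).
Absolute convergence holds because `1 + ρ(θ)` grows at least like `θ^{2/α}`; the series over `n`
converges because the `n`-th mean rate is at most `n + 1` times the one for a single user, and `N`
has finite mean.

Scheduling. Normalized SNR is just the fading gain, so the tagged user is scheduled when its gain is
the largest. By exchangeability and the absence of ties, its gain then has the law of the maximum
(`IsIIDExp.lintegral_cond_top`). -/

namespace Cellular

open Filter Topology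

/-! ### The function `exp (-t)` on `[0, ∞]` -/

/-- The function `t ↦ exp (-t)` on the extended nonnegative reals. -/
noncomputable def nexp (t : ℝ≥0∞) : ℝ≥0∞ := EReal.exp (-(t : EReal))

lemma nexp_zero : nexp 0 = 1 := by simp [nexp]

lemma nexp_top : nexp ⊤ = 0 := by simp [nexp]

lemma nexp_add (a b : ℝ≥0∞) : nexp (a + b) = nexp a * nexp b := by
  simp only [nexp]
  rw [← EReal.exp_add, EReal.coe_ennreal_add, EReal.neg_add, sub_eq_add_neg]
  · left; simp
  · right; simp

lemma continuous_nexp : Continuous nexp :=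
  ENNReal.continuous_exp.comp (continuous_neg.comp continuous_coe_ennreal_ereal)

lemma measurable_nexp : Measurable nexp := continuous_nexp.measurable

lemma nexp_antitone : Antitone nexp := fun a b h => by
  simp only [nexp]
  exact EReal.exp_monotone (EReal.neg_le_neg_iff.2 (EReal.coe_ennreal_le_coe_ennreal_iff.2 h))

lemma nexp_le_one (t : ℝ≥0∞) : nexp t ≤ 1 := nexp_zero ▸ nexp_antitone (zero_le (a := t))

lemma nexp_ne_top (t : ℝ≥0∞) : nexp t ≠ ⊤ := ne_top_of_le_ne_top ENNReal.one_ne_top (nexp_le_one t)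

lemma nexp_ofReal {x : ℝ} (hx : 0 ≤ x) : nexp (ENNReal.ofReal x) = ENNReal.ofReal (Real.exp (-x)) := by
  simp only [nexp]
  rw [EReal.coe_ennreal_ofReal, max_eq_left hx, ← EReal.coe_neg, EReal.exp_coe]

lemma nexp_sum {ι : Type*} (s : Finset ι) (f : ι → ℝ≥0∞) :
    nexp (∑ i ∈ s, f i) = ∏ i ∈ s, nexp (f i) := by
  classical
  induction s using Finset.induction_on with
  | empty => simp [nexp_zero]
  | insert a s ha ih => rw [Finset.sum_insert ha, Finset.prod_insert ha, nexp_add, ih]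

lemma nexp_nat_mul (n : ℕ) (t : ℝ≥0∞) : nexp (n * t) = nexp t ^ n := by
  have := nexp_sum (Finset.range n) (fun _ => t)
  simpa using this

lemma tendsto_nexp_tsum (f : ℕ → ℝ≥0∞) :
    Tendsto (fun n => nexp (∑ i ∈ Finset.range n, f i)) atTop (𝓝 (nexp (∑' i, f i))) :=
  (continuous_nexp.tendsto _).comp ENNReal.summable.hasSum.tendsto_sum_nat

/-- `-ln (1 + a)⁻¹` as a function on `[0, ∞]`. -/
noncomputable def logOnePlus (a : ℝ≥0∞) : ℝ≥0∞ := (ENNReal.log (1 + a)).toENNReal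

/-- Averaging an exponential mark of weight `a` produces the factor `(1 + a)⁻¹`. Written as a value
of `nexp`, products of such factors become sums, and marked functionals reduce to unmarked ones. -/
lemma nexp_logOnePlus (a : ℝ≥0∞) : nexp (logOnePlus a) = (1 + a)⁻¹ := by
  have h : 0 ≤ ENNReal.log (1 + a) := by simp
  rw [nexp, logOnePlus, EReal.coe_toENNReal h, EReal.exp_neg, ENNReal.exp_log]

lemma measurable_logOnePlus : Measurable logOnePlus := by
  unfold logOnePlus
  exact measurable_ereal_toENNReal.comp (ENNReal.measurable_log.comp (by fun_prop))

/-! ### Laplace functional of a Poisson point process -/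

section Laplace

lemma coe_pointCount {Ω : Type*} (X : ℕ → Ω → Plane) (A : Set Plane) (ω : Ω) :
    ((pointCount X A ω : ℕ∞) : ℝ≥0∞) = ∑' i, A.indicator 1 (X i ω) := by
  have h := ENNReal.tsum_set_one {i : ℕ | X i ω ∈ A}
  rw [tsum_subtype {i : ℕ | X i ω ∈ A} (fun _ => (1 : ℝ≥0∞))] at h
  rw [pointCount, ← h]
  rfl

variable {Ω : Type*} [MeasurableSpace Ω]

lemma measurable_pointCount {X : ℕ → Ω → Plane} (hX : ∀ i, Measurable (X i)) {A : Set Plane}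
    (hA : MeasurableSet A) : Measurable (pointCount X A) := by
  have h : Measurable (fun ω => ((pointCount X A ω : ℕ∞) : ℝ≥0∞)) := by
    simp_rw [coe_pointCount]
    exact Measurable.tsum fun i => (measurable_one.indicator hA).comp (hX i)
  refine measurable_to_countable' fun n => ?_
  have : pointCount X A ⁻¹' {n} = (fun ω => ((pointCount X A ω : ℕ∞) : ℝ≥0∞)) ⁻¹' {(n : ℝ≥0∞)} := by
    ext ω; simp
  rw [this]
  exact h (measurableSet_singleton _)

variable {μ : Measure Ω} [IsProbabilityMeasure μ] {lam : ℝ} {X : ℕ → Ω → Plane}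

/-- The law is prescribed only at finite `n`; since the Poisson masses sum to 1, no mass is left for
`⊤`. -/
lemma IsHomogeneousPPP.count_ne_top (hX : IsHomogeneousPPP μ lam X) {A : Set Plane}
    (hA : MeasurableSet A) (hA' : volume A ≠ ∞) : ∀ᵐ ω ∂μ, pointCount X A ω ≠ ⊤ := by
  have hm := measurable_pointCount hX.measurable hA
  have h1 : μ (⋃ n : ℕ, {ω | pointCount X A ω = n}) = 1 := by
    rw [measure_iUnion]
    · simp_rw [hX.count_law A hA hA']
      have := measure_univ (μ := poissonMeasure (lam * volume.real A).toNNReal)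
      rw [← this, ← biUnion_of_singleton univ]
      simp only [mem_univ, iUnion_true]
      rw [measure_iUnion]
      · intro i j hij; simpa using hij
      · simp
    · intro i j hij
      refine Set.disjoint_left.2 fun ω h1 h2 => hij ?_
      have h1' : pointCount X A ω = i := h1
      have h2' : pointCount X A ω = j := h2
      exact_mod_cast h1'.symm.trans h2'
    · intro n
      exact hm (measurableSet_singleton _)
  have h2 : ∀ᵐ ω ∂μ, ω ∈ ⋃ n : ℕ, {ω | pointCount X A ω = n} := by
    refine (mem_ae_iff_prob_eq_one ?_).2 h1
    exact MeasurableSet.iUnion fun n => hm (measurableSet_singleton _)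
  filter_upwards [h2] with ω hω h
  simp only [mem_iUnion, mem_ofPred_eq] at hω
  obtain ⟨n, hn⟩ := hω
  rw [hn] at h
  exact ENat.natCast_ne_top n h

/-- Generating function of the Poisson law at `z = nexp c`. The case `c = ⊤`, that is `z = 0`, is
the void probability. -/
lemma IsHomogeneousPPP.lintegral_nexp_count (hX : IsHomogeneousPPP μ lam X) (hlam : 0 ≤ lam)
    {A : Set Plane} (hA : MeasurableSet A) (hA' : volume A ≠ ∞) (c : ℝ≥0∞) :
    ∫⁻ ω, nexp (pointCount X A ω * c) ∂μ =
      nexp (ENNReal.ofReal lam * (volume A * (1 - nexp c))) := by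
  have hm := measurable_pointCount hX.measurable hA
  have hset : ∀ n : ℕ, MeasurableSet {ω | pointCount X A ω = n} := fun n =>
    hm (measurableSet_singleton _)
  obtain ⟨z, hz0, hz⟩ : ∃ z : ℝ, 0 ≤ z ∧ nexp c = ENNReal.ofReal z :=
    ⟨(nexp c).toReal, ENNReal.toReal_nonneg, (ENNReal.ofReal_toReal (nexp_ne_top c)).symm⟩
  have hz1 : z ≤ 1 := by
    have := nexp_le_one c
    rwa [hz, ENNReal.ofReal_le_one] at this
  have h1 : ∫⁻ ω, nexp (pointCount X A ω * c) ∂μ =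
      ∫⁻ ω, ∑' n : ℕ, {ω | pointCount X A ω = n}.indicator (fun _ => nexp c ^ n) ω ∂μ := by
    refine lintegral_congr_ae ?_
    filter_upwards [hX.count_ne_top hA hA'] with ω hω
    obtain ⟨k, hk⟩ := ENat.ne_top_iff_exists.1 hω
    rw [tsum_eq_single k]
    · rw [indicator_of_mem (by simp [hk]), ← nexp_nat_mul, ← hk]
      simp
    · intro n hn
      refine indicator_of_notMem ?_ _
      simp only [mem_ofPred_eq, ← hk]
      exact_mod_cast hn.symm
  rw [h1, lintegral_tsum fun n => (measurable_const.indicator (hset n)).aemeasurable]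
  set m : ℝ≥0 := (lam * volume.real A).toNNReal with hm'
  have h2 : ∀ n : ℕ, ∫⁻ ω, {ω | pointCount X A ω = n}.indicator (fun _ => nexp c ^ n) ω ∂μ =
      ENNReal.ofReal (Real.exp (-m) * ((z * m) ^ n / n.factorial)) := by
    intro n
    rw [lintegral_indicator (hset n), setLIntegral_const, hX.count_law A hA hA',
      poissonMeasure_singleton, hz, ← ENNReal.ofReal_pow hz0, ← ENNReal.ofReal_mul (by positivity)]
    congr 1
    rw [mul_pow]
    ring
  simp_rw [h2]
  have hs : HasSum (fun n : ℕ => Real.exp (-m) * ((z * m) ^ n / n.factorial))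
      (Real.exp (-m) * Real.exp (z * m)) := by
    have := NormedSpace.expSeries_div_hasSum_exp (z * m : ℝ)
    rw [← Real.exp_eq_exp_ℝ] at this
    exact this.mul_left _
  rw [← ENNReal.ofReal_tsum_of_nonneg (fun n => by positivity) hs.summable, hs.tsum_eq,
    ← Real.exp_add, hz]
  have hmr : (m : ℝ) = lam * volume.real A := by
    rw [hm', Real.coe_toNNReal _ (by positivity)]
  have h3 : ENNReal.ofReal lam * (volume A * (1 - ENNReal.ofReal z)) =
      ENNReal.ofReal (lam * (volume.real A * (1 - z))) := by
    rw [ENNReal.ofReal_mul hlam, ENNReal.ofReal_mul (by positivity), ENNReal.ofReal_sub _ hz0,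
      ofReal_measureReal hA', ENNReal.ofReal_one]
  rw [h3, nexp_ofReal (by have : 0 ≤ 1 - z := by linarith
                          positivity), hmr]
  congr 2
  ring

lemma IsHomogeneousPPP.lintegral_nexp_sum_count (hX : IsHomogeneousPPP μ lam X) (hlam : 0 ≤ lam)
    {m : ℕ} {A : Fin m → Set Plane} (hA : ∀ j, MeasurableSet (A j)) (hA' : ∀ j, volume (A j) ≠ ∞)
    (hd : Pairwise (fun i j => Disjoint (A i) (A j))) (c : Fin m → ℝ≥0∞) :
    ∫⁻ ω, nexp (∑ j, pointCount X (A j) ω * c j) ∂μ =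
      nexp (ENNReal.ofReal lam * ∑ j, volume (A j) * (1 - nexp (c j))) := by
  simp_rw [nexp_sum]
  have hind := (hX.count_indep m A hA hA' hd).comp (fun j n => nexp (n * c j))
    (fun j => Measurable.of_discrete)
  have h := lintegral_prod_eq_prod_lintegral_of_indepFun Finset.univ _ hind
    (fun j => (Measurable.of_discrete (f := fun n : ℕ∞ => nexp (n * c j))).comp
      (measurable_pointCount hX.measurable (hA j)))
  simp only [Function.comp_apply] at h
  rw [h, Finset.mul_sum, nexp_sum]
  exact Finset.prod_congr rfl fun j _ => hX.lintegral_nexp_count hlam (hA j) (hA' j) (c j)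

/-- The fibres over nonzero values are disjoint and of finite area, so the sum over the points is a
weighted sum of independent Poisson counts. -/
lemma IsHomogeneousPPP.lintegral_nexp_simpleFunc (hX : IsHomogeneousPPP μ lam X) (hlam : 0 ≤ lam)
    (φ : SimpleFunc Plane ℝ≥0∞) (hφ : volume (Function.support φ) ≠ ∞) :
    ∫⁻ ω, nexp (∑' i, φ (X i ω)) ∂μ =
      nexp (ENNReal.ofReal lam * ∫⁻ y, (1 - nexp (φ y))) := by
  classical
  -- The value 0 is left out: its fibre has infinite area, and it contributes nothing because `1 -
  -- nexp 0 = 0`.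
  set s := φ.range.filter (· ≠ 0) with hs
  set e := s.equivFin.symm
  set c : Fin s.card → ℝ≥0∞ := fun j => (e j : ℝ≥0∞)
  have hcinj : Function.Injective c := Subtype.val_injective.comp e.injective
  have hc0 : ∀ j, c j ≠ 0 := fun j => (Finset.mem_filter.1 (e j).2).2
  set A : Fin s.card → Set Plane := fun j => φ ⁻¹' {c j}
  have hA : ∀ j, MeasurableSet (A j) := fun j => φ.measurableSet_fiber _
  have hA' : ∀ j, volume (A j) ≠ ∞ := fun j => measure_ne_top_of_subset (fun y hy => by
    have : φ y = c j := hy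
    simp [this, hc0 j]) hφ
  have hd : Pairwise (fun i j => Disjoint (A i) (A j)) := fun i j hij =>
    Set.disjoint_left.2 fun y h1 h2 => hij (hcinj ((show φ y = c i from h1).symm.trans h2))
  have hsum : ∀ (f : ℝ≥0∞ → ℝ≥0∞), f 0 = 0 → ∀ y, f (φ y) =
      ∑ j, (A j).indicator 1 y * f (c j) := by
    intro f hf y
    by_cases hy : φ y = 0
    · rw [hy, hf, Finset.sum_eq_zero]
      intro j _
      rw [indicator_of_notMem, zero_mul]
      intro h
      exact hc0 j ((show φ y = c j from h).symm.trans hy)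
    · have hmem : φ y ∈ s := Finset.mem_filter.2 ⟨φ.mem_range_self y, hy⟩
      set j := e.symm ⟨φ y, hmem⟩
      have hj : c j = φ y := by simp [c, j]
      rw [Finset.sum_eq_single j]
      · have hyj : y ∈ A j := hj.symm
        rw [indicator_of_mem hyj, hj]; simp
      · intro b _ hb
        rw [indicator_of_notMem, zero_mul]
        intro h
        exact hb (hcinj ((show φ y = c b from h).symm.trans hj.symm))
      · simp
  have h1 : ∀ ω, ∑' i, φ (X i ω) = ∑ j, pointCount X (A j) ω * c j := by
    intro ω
    simp_rw [coe_pointCount, ← ENNReal.tsum_mul_right]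
    rw [← Summable.tsum_finsetSum fun _ _ => ENNReal.summable]
    exact tsum_congr fun i => hsum id rfl (X i ω)
  have h2 : ∫⁻ y, (1 - nexp (φ y)) = ∑ j, volume (A j) * (1 - nexp (c j)) := by
    rw [lintegral_congr (hsum (fun t => 1 - nexp t) (by simp [nexp_zero])),
      lintegral_finsetSum]
    · refine Finset.sum_congr rfl fun j _ => ?_
      rw [lintegral_mul_const _ (measurable_one.indicator (hA j)), lintegral_indicator_one (hA j)]
    · exact fun j _ => (measurable_one.indicator (hA j)).mul_const _
  simp_rw [h1]
  rw [h2, hX.lintegral_nexp_sum_count hlam hA hA' hd]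

/-- Laplace functional of a homogeneous Poisson point process. -/
theorem IsHomogeneousPPP.laplace (hX : IsHomogeneousPPP μ lam X) (hlam : 0 ≤ lam)
    {φ : Plane → ℝ≥0∞} (hφ : Measurable φ) :
    ∫⁻ ω, nexp (∑' i, φ (X i ω)) ∂μ =
      nexp (ENNReal.ofReal lam * ∫⁻ y, (1 - nexp (φ y))) := by
  -- Cutting off at radius `n` makes the supports of finite area and keeps the sequence increasing.
  set ψ : ℕ → SimpleFunc Plane ℝ≥0∞ := fun n =>
    (SimpleFunc.eapprox φ n).restrict (Metric.ball 0 n) with hψ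
  have hψ' : ∀ n y, ψ n y = (Metric.ball 0 (n : ℝ)).indicator (SimpleFunc.eapprox φ n) y :=
    fun n y => SimpleFunc.restrict_apply _ measurableSet_ball y
  have hmono : ∀ y, Monotone fun n => ψ n y := by
    intro y n k hnk
    simp only [hψ']
    refine (indicator_le_indicator (SimpleFunc.monotone_eapprox φ hnk y)).trans ?_
    exact indicator_le_indicator_of_subset (Metric.ball_subset_ball (by exact_mod_cast hnk))
      (fun _ => zero_le) y
  have hlim : ∀ y, Tendsto (fun n => ψ n y) atTop (𝓝 (φ y)) := by
    intro y
    refine (SimpleFunc.tendsto_eapprox hφ y).congr' ?_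
    obtain ⟨k, hk⟩ := exists_nat_gt ‖y‖
    filter_upwards [eventually_ge_atTop k] with n hn
    rw [hψ', indicator_of_mem]
    have : (k : ℝ) ≤ n := by exact_mod_cast hn
    simpa using hk.trans_le this
  have hfin : ∀ n, volume (Function.support (ψ n)) ≠ ∞ := by
    intro n
    refine measure_ne_top_of_subset (fun y hy => ?_)
      (measure_ball_lt_top (x := (0 : Plane)) (r := n)).ne
    by_contra h
    exact hy (by rw [hψ', indicator_of_notMem h])
  have hL : Tendsto (fun n => ∫⁻ ω, nexp (∑' i, ψ n (X i ω)) ∂μ) atTop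
      (𝓝 (∫⁻ ω, nexp (∑' i, φ (X i ω)) ∂μ)) := by
    refine tendsto_lintegral_of_dominated_convergence (fun _ => 1) (fun n => ?_)
      (fun n => Eventually.of_forall fun ω => nexp_le_one _) (by simp)
      (Eventually.of_forall fun ω => (continuous_nexp.tendsto _).comp ?_)
    · exact measurable_nexp.comp (Measurable.tsum fun i =>
        (ψ n).measurable.comp (hX.measurable i))
    -- A series over the points is an integral against counting measure, so monotone convergence
    -- applies.
    · simp_rw [← lintegral_count]
      exact lintegral_tendsto_of_tendsto_of_monotone (fun n => measurable_from_top.aemeasurable)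
        (Eventually.of_forall fun i => hmono _) (Eventually.of_forall fun i => hlim _)
  have hR : Tendsto (fun n => ∫⁻ y, (1 - nexp (ψ n y))) atTop (𝓝 (∫⁻ y, (1 - nexp (φ y)))) := by
    refine lintegral_tendsto_of_tendsto_of_monotone
      (fun n => (measurable_const.sub (measurable_nexp.comp (ψ n).measurable)).aemeasurable)
      (Eventually.of_forall fun y => ?_) (Eventually.of_forall fun y => ?_)
    · exact fun n k h => tsub_le_tsub_left (nexp_antitone (hmono y h)) 1
    · exact ENNReal.Tendsto.sub tendsto_const_nhds ((continuous_nexp.tendsto _).comp (hlim y))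
        (Or.inl ENNReal.one_ne_top)
  refine tendsto_nhds_unique hL ?_
  simp_rw [hX.lintegral_nexp_simpleFunc hlam _ (hfin _)]
  exact (continuous_nexp.tendsto _).comp (ENNReal.Tendsto.const_mul hR (Or.inr ENNReal.ofReal_ne_top))

end Laplace


/-! ### Independent exponential marks -/

section Marks

variable {Ω : Type*} [MeasurableSpace Ω] {μ : Measure Ω}

/-- The inner integral stays over `μ` and plays the role of an independent copy: facts about `g`
under `μ` can be applied with `f` frozen. -/
lemma lintegral_comp_of_indepFun [IsProbabilityMeasure μ] {β γ : Type*} [MeasurableSpace β] [MeasurableSpace γ]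
    {f : Ω → β} {g : Ω → γ} (hfg : IndepFun f g μ) (hf : Measurable f) (hg : Measurable g)
    {F : β → γ → ℝ≥0∞} (hF : Measurable (Function.uncurry F)) :
    ∫⁻ ω, F (f ω) (g ω) ∂μ = ∫⁻ ω, ∫⁻ ω', F (f ω) (g ω') ∂μ ∂μ := by
  have h := (indepFun_iff_map_prod_eq_prod_map_map hf.aemeasurable hg.aemeasurable).1 hfg
  have : IsProbabilityMeasure (μ.map g) := Measure.isProbabilityMeasure_map hg.aemeasurable
  calc ∫⁻ ω, F (f ω) (g ω) ∂μ = ∫⁻ p, Function.uncurry F p ∂(μ.map fun ω => (f ω, g ω)) := by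
        rw [lintegral_map hF (hf.prodMk hg)]; rfl
    _ = ∫⁻ x, ∫⁻ y, F x y ∂(μ.map g) ∂(μ.map f) := by
        rw [h, lintegral_prod _ hF.aemeasurable]; rfl
    _ = ∫⁻ ω, ∫⁻ y, F (f ω) y ∂(μ.map g) ∂μ := by
        exact lintegral_map hF.lintegral_prod_right' hf
    _ = _ := by
        refine lintegral_congr fun ω => ?_
        exact lintegral_map (hF.comp measurable_prodMk_left) hg

lemma ae_pos_expMeasure : ∀ᵐ x ∂(expMeasure 1), 0 < x := by
  have := isProbabilityMeasure_expMeasure one_pos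
  have h := cdf_expMeasure_eq one_pos 0
  rw [cdf_eq_real] at h
  have h0 : expMeasure 1 (Iic 0) = 0 := by
    simpa [measureReal_eq_zero_iff] using h
  rw [ae_iff]
  simpa [Iic] using h0

/-- The tilted density `e^{-x} e^{-a x}` is `(1 + a)⁻¹` times the density of the exponential law of
rate `1 + a`. For `a = ⊤` the integrand vanishes because gains are almost surely positive. -/
lemma lintegral_nexp_expMeasure (a : ℝ≥0∞) :
    ∫⁻ x, nexp (ENNReal.ofReal x * a) ∂(expMeasure 1) = (1 + a)⁻¹ := by
  rcases eq_or_ne a ⊤ with rfl | ha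
  · have : ∀ᵐ x ∂(expMeasure 1), nexp (ENNReal.ofReal x * ⊤) = 0 := by
      filter_upwards [ae_pos_expMeasure] with x hx
      rw [ENNReal.mul_top (by simpa using hx), nexp_top]
    rw [lintegral_congr_ae this]
    simp
  · lift a to ℝ≥0 using ha
    have hm : Measurable fun x : ℝ => nexp (ENNReal.ofReal x * a) :=
      measurable_nexp.comp (by fun_prop)
    have hpos : (0 : ℝ) < 1 + a := by positivity
    rw [expMeasure, gammaMeasure, lintegral_withDensity_eq_lintegral_mul _
      (show Measurable (gammaPDF 1 1) from (measurable_gammaPDFReal 1 1).ennreal_ofReal) hm]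
    have h : ∀ x, (gammaPDF 1 1 * fun x : ℝ => nexp (ENNReal.ofReal x * a)) x =
        (1 + (a : ℝ≥0∞))⁻¹ * exponentialPDF (1 + a) x := by
      intro x
      change exponentialPDF 1 x * nexp (ENNReal.ofReal x * a) = _
      rcases lt_or_ge x 0 with hx | hx
      · rw [exponentialPDF_of_neg hx, exponentialPDF_of_neg hx]; simp
      · rw [exponentialPDF_of_nonneg hx, exponentialPDF_of_nonneg hx, ← ENNReal.ofReal_coe_nnreal,
          ← ENNReal.ofReal_mul hx, nexp_ofReal (by positivity), ← ENNReal.ofReal_mul (by positivity),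
          ← ENNReal.ofReal_one, ← ENNReal.ofReal_add (by simp) (by simp),
          ← ENNReal.ofReal_inv_of_pos hpos, ← ENNReal.ofReal_mul (by positivity)]
        congr 1
        rw [← mul_assoc, inv_mul_cancel₀ hpos.ne', one_mul, one_mul, ← Real.exp_add]
        ring_nf
    rw [lintegral_congr h, lintegral_const_mul _
      (show Measurable (exponentialPDF (1 + a)) from
        (measurable_exponentialPDFReal _).ennreal_ofReal),
      lintegral_exponentialPDF_eq_one hpos, mul_one]

lemma IsIIDExp.ae_pos {g : ℕ → Ω → ℝ} (hg : IsIIDExp μ g) : ∀ᵐ ω ∂μ, ∀ i, 0 < g i ω := by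
  rw [ae_all_iff]
  intro i
  refine ae_of_ae_map (hg.measurable i).aemeasurable ?_
  rw [hg.law i]
  exact ae_pos_expMeasure

variable [IsProbabilityMeasure μ]

/-- Independence settles the partial sums; bounded convergence passes to the series, even a
divergent one. -/
lemma IsIIDExp.lintegral_nexp {g : ℕ → Ω → ℝ} (hg : IsIIDExp μ g) (a : ℕ → ℝ≥0∞) :
    ∫⁻ ω, nexp (∑' i, ENNReal.ofReal (g i ω) * a i) ∂μ = nexp (∑' i, logOnePlus (a i)) := by
  have hm : ∀ i, Measurable fun x : ℝ => nexp (ENNReal.ofReal x * a i) :=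
    fun i => measurable_nexp.comp (by fun_prop)
  have hL : Tendsto (fun n => ∫⁻ ω, nexp (∑ i ∈ Finset.range n, ENNReal.ofReal (g i ω) * a i) ∂μ)
      atTop (𝓝 (∫⁻ ω, nexp (∑' i, ENNReal.ofReal (g i ω) * a i) ∂μ)) := by
    refine tendsto_lintegral_of_dominated_convergence (fun _ => 1) (fun n => ?_)
      (fun n => Eventually.of_forall fun ω => nexp_le_one _) (by simp)
      (Eventually.of_forall fun ω => tendsto_nexp_tsum _)
    exact measurable_nexp.comp (Finset.measurable_fun_sum _ fun i _ =>
      (hg.measurable i).ennreal_ofReal.mul_const _)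
  refine tendsto_nhds_unique hL ((tendsto_nexp_tsum _).congr fun n => ?_)
  simp_rw [nexp_sum]
  have h := lintegral_prod_eq_prod_lintegral_of_indepFun (Finset.range n) _
    (hg.indep.comp (fun i x => nexp (ENNReal.ofReal x * a i)) hm)
    (fun i => (hm i).comp (hg.measurable i))
  simp only [Function.comp_apply] at h
  rw [h]
  refine Finset.prod_congr rfl fun i _ => ?_
  rw [nexp_logOnePlus, ← lintegral_nexp_expMeasure, ← hg.law i, lintegral_map (hm i) (hg.measurable i)]

variable {lam : ℝ} {X : ℕ → Ω → Plane} {g : ℕ → Ω → ℝ}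

/-- Laplace functional of a homogeneous Poisson point process with independent exponential
marks. -/
theorem IsHomogeneousPPP.laplace_marked (hX : IsHomogeneousPPP μ lam X) (hlam : 0 ≤ lam)
    (hg : IsIIDExp μ g) (hXg : IndepFun (fun ω i => X i ω) (fun ω i => g i ω) μ)
    {φ : Plane → ℝ≥0∞} (hφ : Measurable φ) :
    ∫⁻ ω, nexp (∑' i, ENNReal.ofReal (g i ω) * φ (X i ω)) ∂μ =
      nexp (ENNReal.ofReal lam * ∫⁻ y, (1 - (1 + φ y)⁻¹)) := by
  have h := lintegral_comp_of_indepFun hXg (measurable_pi_lambda _ hX.measurable)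
    (measurable_pi_lambda _ hg.measurable)
    (F := fun x g => nexp (∑' i, ENNReal.ofReal (g i) * φ (x i))) (by
      refine measurable_nexp.comp (Measurable.tsum fun i => Measurable.mul ?_ ?_)
      · exact ((measurable_pi_apply i).comp measurable_snd).ennreal_ofReal
      · exact hφ.comp ((measurable_pi_apply i).comp measurable_fst))
  rw [h]
  -- With the points frozen, averaging the marks leaves the unmarked functional of `logOnePlus ∘ φ`.
  simp_rw [hg.lintegral_nexp]
  refine (hX.laplace hlam (measurable_logOnePlus.comp hφ)).trans ?_
  simp_rw [Function.comp_apply, nexp_logOnePlus]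

lemma one_sub_inv_one_add_le (a : ℝ≥0∞) : 1 - (1 + a)⁻¹ ≤ a := by
  rw [tsub_le_iff_right]
  rcases eq_or_ne a ⊤ with rfl | ha
  · simp
  · have h1 : (1 + a) ≠ 0 := by simp
    have h2 : (1 + a) ≠ ⊤ := by simp [ha]
    rcases le_total 1 a with h | h
    · exact h.trans le_self_add
    · rw [← ENNReal.mul_le_mul_iff_left h1 h2, add_mul, ENNReal.inv_mul_cancel h1 h2, one_mul,
        add_comm 1 a]
      gcongr
      rw [mul_add, mul_one]
      exact le_add_self

/-- Scale the series `S` by `1/n`. The mean of `nexp (S / n)` is at least `nexp (C / n)`, and at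
most `P(S < ∞)` because the integrand vanishes where `S = ∞`; then let `n → ∞`. -/
lemma IsHomogeneousPPP.ae_tsum_ne_top (hX : IsHomogeneousPPP μ lam X) (hlam : 0 ≤ lam)
    (hg : IsIIDExp μ g) (hXg : IndepFun (fun ω i => X i ω) (fun ω i => g i ω) μ)
    {φ : Plane → ℝ≥0∞} (hφ : Measurable φ) (hφ' : ∫⁻ y, φ y ≠ ⊤) :
    ∀ᵐ ω ∂μ, ∑' i, ENNReal.ofReal (g i ω) * φ (X i ω) ≠ ⊤ := by
  set S : Ω → ℝ≥0∞ := fun ω => ∑' i, ENNReal.ofReal (g i ω) * φ (X i ω)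
  have hS : Measurable S := Measurable.tsum fun i =>
    (hg.measurable i).ennreal_ofReal.mul (hφ.comp (hX.measurable i))
  set C := ENNReal.ofReal lam * ∫⁻ y, φ y
  have hC : C ≠ ⊤ := ENNReal.mul_ne_top ENNReal.ofReal_ne_top hφ'
  have hmeas : MeasurableSet {ω | S ω ≠ ⊤} := (hS (measurableSet_singleton ⊤)).compl
  have key : ∀ n : ℕ, nexp (C * (n : ℝ≥0∞)⁻¹) ≤ μ {ω | S ω ≠ ⊤} := by
    intro n
    have h1 := hX.laplace_marked hlam hg hXg (hφ.mul_const (n : ℝ≥0∞)⁻¹)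
    have h2 : ∫⁻ ω, nexp (∑' i, ENNReal.ofReal (g i ω) * (φ (X i ω) * (n : ℝ≥0∞)⁻¹)) ∂μ ≤
        μ {ω | S ω ≠ ⊤} := by
      rw [← lintegral_indicator_one hmeas]
      refine lintegral_mono fun ω => ?_
      simp_rw [← mul_assoc]
      rw [ENNReal.tsum_mul_right]
      by_cases h : S ω = ⊤
      · rw [show ∑' i, ENNReal.ofReal (g i ω) * φ (X i ω) = ⊤ from h, ENNReal.top_mul (by simp),
          nexp_top]
        simp
      · rw [indicator_of_mem h]
        exact nexp_le_one _
    refine le_trans ?_ (h1 ▸ h2)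
    refine nexp_antitone ?_
    rw [mul_assoc]
    gcongr
    rw [← lintegral_mul_const _ hφ]
    exact lintegral_mono fun y => one_sub_inv_one_add_le _
  have hlim : Tendsto (fun n : ℕ => nexp (C * (n : ℝ≥0∞)⁻¹)) atTop (𝓝 1) := by
    have : Tendsto (fun n : ℕ => C * (n : ℝ≥0∞)⁻¹) atTop (𝓝 (C * 0)) :=
      ENNReal.Tendsto.const_mul ENNReal.tendsto_inv_nat_nhds_zero (Or.inr hC)
    rw [mul_zero] at this
    rw [← nexp_zero]
    exact (continuous_nexp.tendsto _).comp this
  exact (mem_ae_iff_prob_eq_one hmeas).2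
    (le_antisymm prob_le_one (le_of_tendsto' hlim key))

end Marks


/-! ### Radial integration in the plane -/

lemma setOf_sq_norm_lt (b : ℝ) : {y : Plane | ‖y‖ ^ 2 < b} = Metric.ball 0 √b := by
  ext y
  simp [Real.lt_sqrt (norm_nonneg y)]

lemma measurableSet_sq_norm_lt (b : ℝ) : MeasurableSet {y : Plane | ‖y‖ ^ 2 < b} := by
  rw [setOf_sq_norm_lt]; exact measurableSet_ball

/-- For `b < 0` both sides vanish, `√b` and `ENNReal.ofReal b` being 0. -/
lemma volume_sq_norm_lt (b : ℝ) :
    volume {y : Plane | ‖y‖ ^ 2 < b} = ENNReal.ofReal Real.pi * ENNReal.ofReal b := by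
  rw [setOf_sq_norm_lt, EuclideanSpace.volume_ball_fin_two, ← ENNReal.ofReal_pow (Real.sqrt_nonneg b),
    mul_comm]
  congr 1
  rcases le_total 0 b with h | h
  · rw [Real.sq_sqrt h]
  · rw [Real.sqrt_eq_zero_of_nonpos h, ENNReal.ofReal_of_nonpos h]; simp

lemma sq_norm_lt_subset {a b : ℝ} (hab : a ≤ b) :
    {y : Plane | ‖y‖ ^ 2 < a} ⊆ {y : Plane | ‖y‖ ^ 2 < b} :=
  fun _ hy => lt_of_lt_of_le hy hab

lemma volume_sq_norm_lt_ne_top (b : ℝ) : volume {y : Plane | ‖y‖ ^ 2 < b} ≠ ∞ := by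
  rw [volume_sq_norm_lt]
  exact ENNReal.mul_ne_top ENNReal.ofReal_ne_top ENNReal.ofReal_ne_top

/-- A disc of squared radius `b` has area `π b`: in the variable `‖y‖ ^ 2` the plane becomes a
half-line with a constant density. For this reason squared distances are used throughout. -/
lemma map_sq_norm_volume :
    (volume : Measure Plane).map (fun y => ‖y‖ ^ 2) =
      ENNReal.ofReal Real.pi • volume.restrict (Ioi (0 : ℝ)) := by
  have hm : Measurable fun y : Plane => ‖y‖ ^ 2 := by fun_prop
  have hval : ∀ a b : ℝ, a < b → (volume : Measure Plane).map (fun y => ‖y‖ ^ 2) (Ico a b) =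
      ENNReal.ofReal Real.pi * (ENNReal.ofReal b - ENNReal.ofReal a) := by
    intro a b hab
    rw [Measure.map_apply hm measurableSet_Ico]
    have : (fun y : Plane => ‖y‖ ^ 2) ⁻¹' Ico a b =
        {y : Plane | ‖y‖ ^ 2 < b} \ {y : Plane | ‖y‖ ^ 2 < a} := by
      ext y; simp [and_comm]
    rw [this, measure_sdiff (sq_norm_lt_subset hab.le)
      (measurableSet_sq_norm_lt a).nullMeasurableSet (volume_sq_norm_lt_ne_top a),
      volume_sq_norm_lt, volume_sq_norm_lt, ENNReal.mul_sub]
    intros; exact ENNReal.ofReal_ne_top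
  refine Measure.ext_of_Ico' _ _ (fun {a b} hab => ?_) (fun {a b} hab => ?_)
  · rw [hval a b hab]
    exact ENNReal.mul_ne_top ENNReal.ofReal_ne_top (by simp)
  · rw [hval a b hab, Measure.smul_apply, smul_eq_mul, Measure.restrict_congr_set Ioi_ae_eq_Ici,
      Measure.restrict_apply measurableSet_Ico]
    congr 1
    have : Ico a b ∩ Ici 0 = Ico (max a 0) b := by
      ext y; simp only [mem_inter_iff, mem_Ico, mem_Ici, max_le_iff]; tauto
    rw [this, Real.volume_Ico]
    rcases le_total a 0 with h | h
    · rw [max_eq_right h, ENNReal.ofReal_of_nonpos h]; simp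
    · rw [max_eq_left h, ENNReal.ofReal_sub _ h]

lemma lintegral_sq_norm {f : ℝ → ℝ≥0∞} (hf : Measurable f) :
    ∫⁻ y : Plane, f (‖y‖ ^ 2) = ENNReal.ofReal Real.pi * ∫⁻ u in Ioi (0 : ℝ), f u := by
  have hm : Measurable fun y : Plane => ‖y‖ ^ 2 := by fun_prop
  rw [← lintegral_map hf hm, map_sq_norm_volume, lintegral_smul_measure, smul_eq_mul]

/-! ### Almost sure properties of the configuration -/

section Configuration

variable {Ω : Type*} [MeasurableSpace Ω] {μ : Measure Ω} [IsProbabilityMeasure μ]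
  {lam : ℝ} {X : ℕ → Ω → Plane} {g : ℕ → Ω → ℝ}

lemma IsHomogeneousPPP.ae_finite (hX : IsHomogeneousPPP μ lam X) :
    ∀ᵐ ω ∂μ, ∀ b : ℝ, {i | ‖X i ω‖ ^ 2 < b}.Finite := by
  have h : ∀ᵐ ω ∂μ, ∀ n : ℕ, {i | ‖X i ω‖ ^ 2 < (n : ℝ)}.Finite := by
    rw [ae_all_iff]
    intro n
    filter_upwards [hX.count_ne_top (measurableSet_sq_norm_lt n) (volume_sq_norm_lt_ne_top n)]
      with ω hω
    exact Set.encard_ne_top_iff.1 hω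
  filter_upwards [h] with ω hω b
  obtain ⟨n, hn⟩ := exists_nat_gt b
  exact (hω n).subset fun i (hi : _ < b) => lt_trans hi hn

/-- A minimiser among the finitely many points of squared norm below `‖x 0‖ ^ 2 + 1` is a global
one. Its existence makes the `sInf` in `nearestBS` a true minimiser and not the default value 0. -/
lemma exists_isLeast_norm {x : ℕ → Plane} (hx : ∀ b : ℝ, {i | ‖x i‖ ^ 2 < b}.Finite) :
    ∀ j, ‖x (nearestBS x)‖ ≤ ‖x j‖ := by
  have hne : {i | ∀ j, ‖x i‖ ≤ ‖x j‖}.Nonempty := by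
    have hfin := hx (‖x 0‖ ^ 2 + 1)
    obtain ⟨i, hi, hmin⟩ := Set.exists_min_image _ (fun i => ‖x i‖) hfin ⟨0, by simp⟩
    refine ⟨i, fun j => ?_⟩
    by_cases hj : ‖x j‖ ^ 2 < ‖x 0‖ ^ 2 + 1
    · exact hmin j hj
    · have h1 : ‖x i‖ ^ 2 < ‖x 0‖ ^ 2 + 1 := hi
      refine le_of_lt (lt_of_pow_lt_pow_left₀ 2 (norm_nonneg _) ?_)
      linarith
  exact Nat.sInf_mem hne

/-- From `e^{-m} ≥ 1 - m` and `(1 + m) (1 - m) = 1 - m²`. A bound quadratic in `m` is what makes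
ties negligible on a fine grid. -/
lemma poissonMeasure_ge_two_le (m : ℝ≥0) :
    1 - (poissonMeasure m {0} + poissonMeasure m {1}) ≤ ENNReal.ofReal (m ^ 2) := by
  rw [poissonMeasure_singleton, poissonMeasure_singleton, ← ENNReal.ofReal_add (by positivity)
    (by positivity), ← ENNReal.ofReal_one, ← ENNReal.ofReal_sub _ (by positivity)]
  refine ENNReal.ofReal_le_ofReal ?_
  have h := Real.add_one_le_exp (-(m : ℝ))
  have hm : (0 : ℝ) ≤ m := m.2
  simp only [pow_zero, pow_one, Nat.factorial_zero, Nat.factorial_one, Nat.cast_one, div_one]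
  nlinarith [mul_le_mul_of_nonneg_left h (by linarith : (0 : ℝ) ≤ 1 + m)]

lemma IsHomogeneousPPP.measure_two_le_count (hX : IsHomogeneousPPP μ lam X)
    {A : Set Plane} (hA : MeasurableSet A) (hA' : volume A ≠ ∞) :
    μ {ω | 2 ≤ pointCount X A ω} ≤ ENNReal.ofReal ((lam * volume.real A).toNNReal ^ 2) := by
  have hm := measurable_pointCount hX.measurable hA
  refine le_trans ?_ (poissonMeasure_ge_two_le _)
  rw [← hX.count_law A hA hA', ← hX.count_law A hA hA', ← measure_union]
  · have h1 : MeasurableSet ({ω | pointCount X A ω = (0 : ℕ)} ∪ {ω | pointCount X A ω = (1 : ℕ)}) :=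
      (hm (measurableSet_singleton _)).union (hm (measurableSet_singleton _))
    rw [← prob_compl_eq_one_sub h1]
    refine measure_mono ?_
    intro ω hω h
    replace hω : 2 ≤ pointCount X A ω := hω
    rcases h with h | h
    · have h' : pointCount X A ω = (0 : ℕ) := h
      rw [h'] at hω; exact absurd hω (by decide)
    · have h' : pointCount X A ω = (1 : ℕ) := h
      rw [h'] at hω; exact absurd hω (by decide)
  · refine Set.disjoint_left.2 fun ω h1 h2 => ?_
    have h1' : pointCount X A ω = (0 : ℕ) := h1
    have h2' : pointCount X A ω = (1 : ℕ) := h2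
    rw [h1'] at h2'; exact absurd h2' (by decide)
  · exact hm (measurableSet_singleton _)

/-! ### A grid on the axis of squared distances, and absence of ties. -/

/-- The left end point of the grid cell of width `1 / (m + 1)` that contains `v`. -/
noncomputable def gridFloor (m : ℕ) (v : ℝ) : ℝ := ⌊((m : ℝ) + 1) * v⌋₊ / ((m : ℝ) + 1)

lemma gridFloor_le (m : ℕ) {v : ℝ} (hv : 0 ≤ v) : gridFloor m v ≤ v := by
  have : (0 : ℝ) < m + 1 := by positivity
  rw [gridFloor, div_le_iff₀ this, mul_comm v]
  exact Nat.floor_le (by positivity)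

lemma lt_gridFloor_add (m : ℕ) (v : ℝ) : v < gridFloor m v + 1 / ((m : ℝ) + 1) := by
  have : (0 : ℝ) < m + 1 := by positivity
  rw [gridFloor, ← add_div, lt_div_iff₀ this, mul_comm v]
  exact Nat.lt_floor_add_one _

lemma gridFloor_nonneg (m : ℕ) (v : ℝ) : 0 ≤ gridFloor m v := by
  unfold gridFloor; positivity

lemma floor_eq_of_mem_cell {m k : ℕ} {v : ℝ} (h1 : (k : ℝ) / (m + 1) ≤ v)
    (h2 : v < ((k : ℝ) + 1) / (m + 1)) : ⌊((m : ℝ) + 1) * v⌋₊ = k := by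
  have : (0 : ℝ) < m + 1 := by positivity
  have hv : 0 ≤ v := le_trans (by positivity) h1
  rw [Nat.floor_eq_iff (by positivity)]
  rw [div_le_iff₀ this] at h1
  rw [lt_div_iff₀ this] at h2
  constructor <;> linarith

lemma measurable_gridFloor (m : ℕ) : Measurable (gridFloor m) := by
  unfold gridFloor
  have : Measurable fun v : ℝ => ⌊((m : ℝ) + 1) * v⌋₊ := Nat.measurable_floor.comp (by fun_prop)
  exact (measurable_from_top.comp this).div_const _

lemma tendsto_gridFloor {v : ℝ} (hv : 0 ≤ v) : Tendsto (fun m => gridFloor m v) atTop (𝓝 v) := by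
  have h : Tendsto (fun m : ℕ => v - 1 / ((m : ℝ) + 1)) atTop (𝓝 v) := by
    simpa using tendsto_const_nhds.sub (tendsto_one_div_add_atTop_nhds_zero_nat (𝕜 := ℝ))
  refine tendsto_of_tendsto_of_tendsto_of_le_of_le h tendsto_const_nhds (fun m => ?_)
    (fun m => gridFloor_le m hv)
  have := lt_gridFloor_add m v
  simp only
  linarith

lemma tendsto_gridFloor_add {v : ℝ} (hv : 0 ≤ v) :
    Tendsto (fun m => gridFloor m v + 1 / ((m : ℝ) + 1)) atTop (𝓝 v) := by
  simpa using (tendsto_gridFloor hv).add (tendsto_one_div_add_atTop_nhds_zero_nat (𝕜 := ℝ))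

/-- The annulus of points whose squared distance to the origin lies in `[a, b)`. -/
def annulus (a b : ℝ) : Set Plane := {y | a ≤ ‖y‖ ^ 2 ∧ ‖y‖ ^ 2 < b}

lemma measurableSet_annulus (a b : ℝ) : MeasurableSet (annulus a b) := by
  have : annulus a b = {y : Plane | ‖y‖ ^ 2 < a}ᶜ ∩ {y : Plane | ‖y‖ ^ 2 < b} := by
    ext y; simp [annulus]
  rw [this]
  exact (measurableSet_sq_norm_lt a).compl.inter (measurableSet_sq_norm_lt b)

lemma volume_annulus_ne_top (a b : ℝ) : volume (annulus a b) ≠ ∞ :=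
  measure_ne_top_of_subset (fun _ hy => hy.2) (volume_sq_norm_lt_ne_top b)

lemma volume_real_annulus {a b : ℝ} (ha : 0 ≤ a) (hab : a ≤ b) :
    volume.real (annulus a b) = Real.pi * (b - a) := by
  have h : volume (annulus a b) = ENNReal.ofReal (Real.pi * (b - a)) := by
    have : annulus a b = {y : Plane | ‖y‖ ^ 2 < b} \ {y : Plane | ‖y‖ ^ 2 < a} := by
      ext y; simp [annulus, and_comm]
    rw [this, measure_sdiff (sq_norm_lt_subset hab)
      (measurableSet_sq_norm_lt a).nullMeasurableSet (volume_sq_norm_lt_ne_top a),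
      volume_sq_norm_lt, volume_sq_norm_lt, ENNReal.ofReal_mul Real.pi_pos.le,
      ENNReal.ofReal_sub _ ha, ENNReal.mul_sub]
    intros; exact ENNReal.ofReal_ne_top
  rw [measureReal_def, h, ENNReal.toReal_ofReal]
  have : 0 ≤ b - a := by linarith
  have := Real.pi_pos
  positivity

/-- Almost surely no two points of the process have the same distance to the origin. -/
lemma IsHomogeneousPPP.ae_injective_norm (hX : IsHomogeneousPPP μ lam X) (hlam : 0 ≤ lam) :
    ∀ᵐ ω ∂μ, ∀ i j, i ≠ j → ‖X i ω‖ ≠ ‖X j ω‖ := by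
  have key : ∀ K : ℕ, μ {ω | ∃ i j, i ≠ j ∧ ‖X i ω‖ = ‖X j ω‖ ∧ ‖X i ω‖ ^ 2 < (K : ℝ)} = 0 := by
    intro K
    set T := {ω | ∃ i j, i ≠ j ∧ ‖X i ω‖ = ‖X j ω‖ ∧ ‖X i ω‖ ^ 2 < (K : ℝ)}
    -- A tie within squared radius `K` puts two points in one of `K (m + 1)` annuli of area `π / (m
    -- + 1)`. Each annulus does so with probability at most `(lam π / (m + 1))²`, a total of order
    -- `1 / m`.
    have hbound : ∀ m : ℕ, μ T ≤
        ENNReal.ofReal ((K * (lam * Real.pi) ^ 2) * (1 / ((m : ℝ) + 1))) := by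
      intro m
      have hm0 : (0 : ℝ) < m + 1 := by positivity
      set A : ℕ → Set Plane := fun k => annulus ((k : ℝ) / (m + 1)) (((k : ℝ) + 1) / (m + 1))
      have hsub : T ⊆ ⋃ k ∈ Finset.range (K * (m + 1)), {ω | 2 ≤ pointCount X (A k) ω} := by
        rintro ω ⟨i, j, hij, heq, hlt⟩
        simp only [mem_iUnion, Finset.mem_range]
        have hcell : ∀ l, ‖X l ω‖ = ‖X i ω‖ → X l ω ∈ A ⌊((m : ℝ) + 1) * ‖X i ω‖ ^ 2⌋₊ := by
          intro l hl
          constructor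
          · rw [hl]; exact gridFloor_le m (by positivity)
          · rw [hl, add_div]; exact lt_gridFloor_add m _
        refine ⟨⌊((m : ℝ) + 1) * ‖X i ω‖ ^ 2⌋₊, ?_, ?_⟩
        · rw [Nat.floor_lt (by positivity)]
          push_cast
          rw [mul_comm]
          gcongr
        · have : ({i, j} : Set ℕ) ⊆ {l | X l ω ∈ A ⌊((m : ℝ) + 1) * ‖X i ω‖ ^ 2⌋₊} := by
            rintro l (rfl | rfl)
            · exact hcell _ rfl
            · exact hcell _ heq.symm
          have h2 := Set.encard_le_encard this
          rwa [Set.encard_pair hij] at h2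
      refine (measure_mono hsub).trans ((measure_biUnion_finset_le _ _).trans ?_)
      have h1 : ∀ k ∈ Finset.range (K * (m + 1)), μ {ω | 2 ≤ pointCount X (A k) ω} ≤
          ENNReal.ofReal ((lam * (Real.pi * (1 / ((m : ℝ) + 1)))) ^ 2) := by
        intro k _
        refine (hX.measure_two_le_count (measurableSet_annulus _ _) (volume_annulus_ne_top _ _)).trans
          (le_of_eq ?_)
        rw [volume_real_annulus (by positivity) (by gcongr; linarith), ← sub_div, add_sub_cancel_left,
          Real.coe_toNNReal _ (by positivity)]
      refine (Finset.sum_le_sum h1).trans (le_of_eq ?_)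
      rw [Finset.sum_const, Finset.card_range, nsmul_eq_mul, ← ENNReal.ofReal_natCast,
        ← ENNReal.ofReal_mul (by positivity)]
      congr 1
      push_cast
      field_simp
    have hlim : Tendsto (fun m : ℕ => ENNReal.ofReal ((K * (lam * Real.pi) ^ 2) * (1 / ((m : ℝ) + 1))))
        atTop (𝓝 0) := by
      have := (tendsto_one_div_add_atTop_nhds_zero_nat (𝕜 := ℝ)).const_mul (K * (lam * Real.pi) ^ 2)
      simpa using ENNReal.tendsto_ofReal this
    exact le_antisymm (ge_of_tendsto' hlim hbound) (zero_le)
  have h : ∀ᵐ ω ∂μ, ∀ K : ℕ, ¬ ∃ i j, i ≠ j ∧ ‖X i ω‖ = ‖X j ω‖ ∧ ‖X i ω‖ ^ 2 < (K : ℝ) := by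
    rw [ae_all_iff]
    intro K
    rw [ae_iff]
    simpa using key K
  filter_upwards [h] with ω hω i j hij heq
  obtain ⟨K, hK⟩ := exists_nat_gt (‖X i ω‖ ^ 2)
  exact hω K ⟨i, j, hij, heq, hK⟩

/-! ### Void events and the law of the nearest point. -/

/-- The event that the squared distance from the origin to the nearest point lies in `[a, b)`. -/
def nearestCell (X : ℕ → Ω → Plane) (a b : ℝ) : Set Ω :=
  {ω | (∀ i, a ≤ ‖X i ω‖ ^ 2) ∧ ∃ i, ‖X i ω‖ ^ 2 < b}

lemma measurableSet_void (hX : ∀ i, Measurable (X i)) (a : ℝ) :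
    MeasurableSet {ω | ∀ i, a ≤ ‖X i ω‖ ^ 2} := by
  rw [show {ω | ∀ i, a ≤ ‖X i ω‖ ^ 2} = ⋂ i, {ω | a ≤ ‖X i ω‖ ^ 2} by ext; simp]
  exact MeasurableSet.iInter fun i =>
    measurableSet_le measurable_const ((hX i).norm.pow_const 2)

lemma measurableSet_nearestCell (hX : ∀ i, Measurable (X i)) (a b : ℝ) :
    MeasurableSet (nearestCell X a b) := by
  rw [show nearestCell X a b = {ω | ∀ i, a ≤ ‖X i ω‖ ^ 2} \ {ω | ∀ i, b ≤ ‖X i ω‖ ^ 2} by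
    ext; simp [nearestCell]]
  exact (measurableSet_void hX a).diff (measurableSet_void hX b)

/-- Give weight `⊤` to the points inside the disc. As marks are positive, `nexp` then vanishes as
soon as one point is inside, so the restricted integral is an unrestricted Laplace functional; its
exponent splits into the area of the disc and the contribution of `f`. -/
lemma IsHomogeneousPPP.setLIntegral_void (hX : IsHomogeneousPPP μ lam X) (hlam : 0 ≤ lam)
    (hg : IsIIDExp μ g) (hXg : IndepFun (fun ω i => X i ω) (fun ω i => g i ω) μ)
    {f : ℝ → ℝ≥0∞} (hf : Measurable f) {r : ℝ} (hfr : ∀ u < r, f u = 0) :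
    ∫⁻ ω in {ω | ∀ i, r ≤ ‖X i ω‖ ^ 2},
        nexp (∑' i, ENNReal.ofReal (g i ω) * f (‖X i ω‖ ^ 2)) ∂μ =
      nexp (ENNReal.ofReal lam * (ENNReal.ofReal Real.pi * ENNReal.ofReal r)) *
        nexp (ENNReal.ofReal lam * (ENNReal.ofReal Real.pi * ∫⁻ u in Ioi 0, (1 - (1 + f u)⁻¹))) := by
  set φ : Plane → ℝ≥0∞ := fun y => if ‖y‖ ^ 2 < r then ⊤ else f (‖y‖ ^ 2) with hφdef
  have hφ : Measurable φ := Measurable.ite (measurableSet_sq_norm_lt r) measurable_const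
    (hf.comp (by fun_prop))
  have h1 : ∫⁻ ω in {ω | ∀ i, r ≤ ‖X i ω‖ ^ 2},
        nexp (∑' i, ENNReal.ofReal (g i ω) * f (‖X i ω‖ ^ 2)) ∂μ =
      ∫⁻ ω, nexp (∑' i, ENNReal.ofReal (g i ω) * φ (X i ω)) ∂μ := by
    rw [← lintegral_indicator (measurableSet_void hX.measurable r)]
    refine lintegral_congr_ae ?_
    filter_upwards [hg.ae_pos] with ω hω
    by_cases h : ∀ i, r ≤ ‖X i ω‖ ^ 2
    · rw [indicator_of_mem (by exact h)]
      congr 1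
      refine tsum_congr fun i => ?_
      rw [hφdef]
      simp only [if_neg (not_lt.2 (h i))]
    · rw [indicator_of_notMem (by exact h)]
      push Not at h
      obtain ⟨i, hi⟩ := h
      rw [ENNReal.tsum_eq_top_of_eq_top ⟨i, ?_⟩, nexp_top]
      rw [hφdef]
      simp only [if_pos hi]
      exact ENNReal.mul_top (by simpa using hω i)
  rw [h1, hX.laplace_marked hlam hg hXg hφ, ← nexp_add, ← mul_add, ← volume_sq_norm_lt r,
    ← lintegral_sq_norm (f := fun u => 1 - (1 + f u)⁻¹) (by fun_prop),
    ← lintegral_indicator_one (measurableSet_sq_norm_lt r), ← lintegral_add_left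
      (measurable_one.indicator (measurableSet_sq_norm_lt r))]
  congr 2
  refine lintegral_congr fun y => ?_
  by_cases h : ‖y‖ ^ 2 < r
  · rw [indicator_of_mem (by exact h), hfr _ h]
    simp [hφdef, h]
  · rw [indicator_of_notMem (by exact h)]
    simp [hφdef, h]

lemma lintegral_exp_Ico {c a b : ℝ} (hc : 0 < c) (hab : a ≤ b) :
    ∫⁻ v in Ico a b, ENNReal.ofReal (c * Real.exp (-(c * v))) =
      ENNReal.ofReal (Real.exp (-(c * a)) - Real.exp (-(c * b))) := by
  rw [← ofReal_integral_eq_lintegral_ofReal, integral_Ico_eq_integral_Ioc,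
    ← intervalIntegral.integral_of_le hab]
  · have : ∀ x ∈ uIcc a b, HasDerivAt (fun v => -Real.exp (-(c * v))) (c * Real.exp (-(c * x))) x := by
      intro x _
      have := ((((hasDerivAt_id x).const_mul c).neg).exp).neg
      convert! this using 1
      simp; ring
    rw [intervalIntegral.integral_eq_sub_of_hasDerivAt this
      ((by fun_prop : Continuous fun v => c * Real.exp (-(c * v))).intervalIntegrable _ _)]
    congr 1
    ring
  · exact ((by fun_prop : Continuous fun v => c * Real.exp (-(c * v))).integrableOn_Icc).mono_set
      Ico_subset_Icc_self
  · exact Eventually.of_forall fun v => by positivity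

/-- The void event for `a` is the disjoint union of the cell event and the void event for `b`. Since
`f` vanishes below `b`, both void integrals carry the same interference factor, and subtracting
leaves the increment of the law of the squared nearest distance. -/
lemma IsHomogeneousPPP.setLIntegral_nearestCell (hX : IsHomogeneousPPP μ lam X) (hlam : 0 < lam)
    (hg : IsIIDExp μ g) (hXg : IndepFun (fun ω i => X i ω) (fun ω i => g i ω) μ)
    {f : ℝ → ℝ≥0∞} (hf : Measurable f) {a b : ℝ} (ha : 0 ≤ a) (hab : a ≤ b)
    (hfb : ∀ u < b, f u = 0) :
    ∫⁻ ω in nearestCell X a b,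
        nexp (∑' i, ENNReal.ofReal (g i ω) * f (‖X i ω‖ ^ 2)) ∂μ =
      (∫⁻ v in Ico a b, ENNReal.ofReal (Real.pi * lam * Real.exp (-(Real.pi * lam * v)))) *
        nexp (ENNReal.ofReal lam * (ENNReal.ofReal Real.pi * ∫⁻ u in Ioi 0, (1 - (1 + f u)⁻¹))) := by
  set Z : Ω → ℝ≥0∞ := fun ω => nexp (∑' i, ENNReal.ofReal (g i ω) * f (‖X i ω‖ ^ 2))
  set K := nexp (ENNReal.ofReal lam * (ENNReal.ofReal Real.pi * ∫⁻ u in Ioi 0, (1 - (1 + f u)⁻¹)))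
  have hpi := Real.pi_pos
  have hr : ∀ r : ℝ, 0 ≤ r → nexp (ENNReal.ofReal lam * (ENNReal.ofReal Real.pi * ENNReal.ofReal r)) =
      ENNReal.ofReal (Real.exp (-(Real.pi * lam * r))) := by
    intro r hr
    rw [← ENNReal.ofReal_mul hpi.le, ← ENNReal.ofReal_mul hlam.le, nexp_ofReal (by positivity)]
    congr 3; ring
  have h1 := hX.setLIntegral_void hlam.le hg hXg hf (r := b) hfb
  have h2 := hX.setLIntegral_void hlam.le hg hXg hf (r := a) (fun u hu => hfb u (hu.trans_le hab))
  have hunion : {ω | ∀ i, a ≤ ‖X i ω‖ ^ 2} = nearestCell X a b ∪ {ω | ∀ i, b ≤ ‖X i ω‖ ^ 2} := by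
    ext ω
    simp only [nearestCell, mem_ofPred_eq, mem_union]
    constructor
    · intro h
      by_cases hb : ∀ i, b ≤ ‖X i ω‖ ^ 2
      · exact Or.inr hb
      · push Not at hb
        exact Or.inl ⟨h, hb⟩
    · rintro (h | h)
      · exact h.1
      · exact fun i => hab.trans (h i)
  have hdisj : Disjoint (nearestCell X a b) {ω | ∀ i, b ≤ ‖X i ω‖ ^ 2} :=
    Set.disjoint_left.2 fun ω h1 h2 => by
      obtain ⟨i, hi⟩ := h1.2
      exact absurd (h2 i) (not_le.2 hi)
  rw [hunion, lintegral_union (measurableSet_void hX.measurable b) hdisj, h1, hr a ha, hr b (ha.trans hab)] at h2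
  have hKtop : ENNReal.ofReal (Real.exp (-(Real.pi * lam * b))) * K ≠ ⊤ :=
    ENNReal.mul_ne_top ENNReal.ofReal_ne_top (nexp_ne_top _)
  rw [ENNReal.eq_sub_of_add_eq hKtop h2, lintegral_exp_Ico (by positivity) hab,
    ENNReal.ofReal_sub _ (by positivity), ENNReal.sub_mul]
  intros; exact nexp_ne_top _

end Configuration


/-! ### Laplace transform of the reciprocal signal-to-interference ratio -/

/-- Path loss `u ^ (-β)` of the points whose squared distance `u` exceeds `b`. -/
noncomputable def lossBeyond (β b u : ℝ) : ℝ≥0∞ := if b < u then ENNReal.ofReal (u ^ (-β)) else 0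

/-- Path loss `u ^ (-β)` of the points whose squared distance `u` is at least `b`. -/
noncomputable def lossFrom (β b u : ℝ) : ℝ≥0∞ := if b ≤ u then ENNReal.ofReal (u ^ (-β)) else 0

lemma measurable_lossBeyond (β b : ℝ) : Measurable (lossBeyond β b) :=
  Measurable.ite measurableSet_Ioi (by fun_prop) measurable_const

lemma measurable_lossFrom (β b : ℝ) : Measurable (lossFrom β b) :=
  Measurable.ite measurableSet_Ici (by fun_prop) measurable_const

lemma lossFrom_eq_zero {β b u : ℝ} (h : u < b) : lossFrom β b u = 0 := if_neg (not_le.2 h)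

lemma lossFrom_le_lossBeyond {β a b u : ℝ} (h : a < b) : lossFrom β b u ≤ lossBeyond β a u := by
  unfold lossFrom lossBeyond
  split_ifs with h1 h2
  · exact le_rfl
  · exact absurd (h.trans_le h1) h2
  · exact zero_le
  · exact le_rfl

/-- The cut-offs approach `v` strictly from above, so a point at squared distance exactly `v`, such
as the serving station, is dropped in the limit too. -/
lemma tendsto_lossFrom {β v u : ℝ} {b : ℕ → ℝ} (hb : Tendsto b atTop (𝓝 v)) (hb' : ∀ m, v < b m) :
    Tendsto (fun m => lossFrom β (b m) u) atTop (𝓝 (lossBeyond β v u)) := by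
  refine tendsto_const_nhds.congr' ?_
  rcases lt_or_ge v u with h | h
  · filter_upwards [hb.eventually_lt_const h] with m hm
    rw [lossFrom, lossBeyond, if_pos h, if_pos hm.le]
  · refine Eventually.of_forall fun m => ?_
    beta_reduce
    rw [lossFrom_eq_zero (h.trans_lt (hb' m)), lossBeyond, if_neg (not_lt.2 h)]

/-- The assumption `α > 2` enters as `β = α / 2 > 1`; `v > 0` keeps away from the singularity at 0.
-/
lemma lintegral_lossBeyond_ne_top {β v : ℝ} (hβ : 1 < β) (hv : 0 < v) :
    ∫⁻ u in Ioi 0, lossBeyond β v u ≠ ⊤ := by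
  have h : ∀ u, lossBeyond β v u = (Ioi v).indicator (fun u => ENNReal.ofReal (u ^ (-β))) u := by
    intro u; simp [lossBeyond, indicator]
  simp_rw [h]
  rw [lintegral_indicator measurableSet_Ioi]
  refine ne_top_of_le_ne_top ?_ (lintegral_mono' (Measure.restrict_mono le_rfl Measure.restrict_le_self) le_rfl)
  exact (integrableOn_Ioi_rpow_of_lt (by linarith : -β < -1) hv).lintegral_lt_top.ne

section LaplaceTransform

variable {Ω : Type*} [MeasurableSpace Ω] {μ : Measure Ω} [IsProbabilityMeasure μ]
  {lam : ℝ} {X : ℕ → Ω → Plane} {g : ℕ → Ω → ℝ} {β : ℝ}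

/-- One null set has to serve all `v`, because `v` will be the random squared serving distance. The
cut-off 1 is treated first; any other cut-off adds at most the terms of the finitely many points of
squared norm below 2. -/
lemma IsHomogeneousPPP.ae_tsum_lossBeyond_ne_top (hX : IsHomogeneousPPP μ lam X) (hlam : 0 ≤ lam)
    (hg : IsIIDExp μ g) (hXg : IndepFun (fun ω i => X i ω) (fun ω i => g i ω) μ) (hβ : 1 < β) :
    ∀ᵐ ω ∂μ, ∀ v, ∑' i, ENNReal.ofReal (g i ω) * lossBeyond β v (‖X i ω‖ ^ 2) ≠ ⊤ := by
  have hfin : ∫⁻ y : Plane, lossBeyond β 1 (‖y‖ ^ 2) ≠ ⊤ := by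
    rw [lintegral_sq_norm (measurable_lossBeyond β 1)]
    exact ENNReal.mul_ne_top ENNReal.ofReal_ne_top (lintegral_lossBeyond_ne_top hβ one_pos)
  filter_upwards [hX.ae_tsum_ne_top hlam hg hXg
    ((measurable_lossBeyond β 1).comp (by fun_prop)) hfin, hX.ae_finite] with ω h1 h2 v
  set F : ℕ → ℝ≥0∞ := fun i => ENNReal.ofReal (g i ω) * lossBeyond β v (‖X i ω‖ ^ 2)
  have hle : ∀ i, F i ≤ ENNReal.ofReal (g i ω) * lossBeyond β 1 (‖X i ω‖ ^ 2) +
      if i ∈ (h2 2).toFinset then F i else 0 := by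
    intro i
    split_ifs with hi
    · exact le_add_self
    · rw [add_zero]
      have hi' : 2 ≤ ‖X i ω‖ ^ 2 := by simpa using hi
      refine mul_le_mul_right ?_ _
      unfold lossBeyond
      rw [if_pos (by linarith : 1 < ‖X i ω‖ ^ 2)]
      split_ifs
      · exact le_rfl
      · exact zero_le
  refine ne_top_of_le_ne_top ?_ (ENNReal.tsum_le_tsum hle)
  rw [ENNReal.tsum_add, ENNReal.add_ne_top]
  refine ⟨h1, ?_⟩
  rw [tsum_eq_sum (s := (h2 2).toFinset) fun i hi => if_neg hi]
  refine (ENNReal.sum_lt_top.2 fun i hi => ?_).ne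
  rw [if_pos hi]
  refine ENNReal.mul_lt_top ENNReal.ofReal_lt_top ?_
  unfold lossBeyond
  split_ifs <;> simp

/-- The reciprocal of the signal-to-interference-and-noise ratio for unit gain, when the squared
serving distance is `v` and `s` is the normalised noise power. -/
noncomputable def invSnr (β s v : ℝ) (x : ℕ → Plane) (γ : ℕ → ℝ) : ℝ≥0∞ :=
  ENNReal.ofReal (v ^ β) * (ENNReal.ofReal s + ∑' i, ENNReal.ofReal (γ i) * lossBeyond β v (‖x i‖ ^ 2))

/-- The integrand of the discretised Laplace transform. -/
noncomputable def cellWeight (lam β s θ : ℝ) (v : ℝ) (f : ℝ → ℝ≥0∞) : ℝ≥0∞ :=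
  nexp (ENNReal.ofReal θ * (ENNReal.ofReal (v ^ β) * ENNReal.ofReal s)) *
    nexp (ENNReal.ofReal lam * (ENNReal.ofReal Real.pi *
      ∫⁻ u in Ioi 0, (1 - (1 + ENNReal.ofReal θ * ENNReal.ofReal (v ^ β) * f u)⁻¹)))

lemma cellWeight_le_one (lam β s θ v : ℝ) (f : ℝ → ℝ≥0∞) : cellWeight lam β s θ v f ≤ 1 :=
  mul_le_one' (nexp_le_one _) (nexp_le_one _)

/-- Grid approximation of `invSnr`. -/
noncomputable def gridInvSnr (m : ℕ) (β s v : ℝ) (x : ℕ → Plane) (γ : ℕ → ℝ) : ℝ≥0∞ :=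
  ENNReal.ofReal (gridFloor m v ^ β) * (ENNReal.ofReal s + ∑' i, ENNReal.ofReal (γ i) *
    lossFrom β (gridFloor m v + 1 / ((m : ℝ) + 1)) (‖x i‖ ^ 2))

/-- On each cell the grid values are constant and only points from the right end of the cell onwards
are counted, which is exactly the setting of `setLIntegral_nearestCell`; the results are summed over
the cells. -/
lemma IsHomogeneousPPP.lintegral_gridInvSnr (hX : IsHomogeneousPPP μ lam X) (hlam : 0 < lam)
    (hg : IsIIDExp μ g) (hXg : IndepFun (fun ω i => X i ω) (fun ω i => g i ω) μ)
    (s θ : ℝ) (m : ℕ) {V : Ω → ℝ} (hV : ∀ᵐ ω ∂μ, (∀ i, V ω ≤ ‖X i ω‖ ^ 2) ∧ ∃ i, V ω = ‖X i ω‖ ^ 2) :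
    ∫⁻ ω, nexp (ENNReal.ofReal θ *
        gridInvSnr m β s (V ω) (fun i => X i ω) (fun i => g i ω)) ∂μ =
      ∫⁻ v in Ici 0, ENNReal.ofReal (Real.pi * lam * Real.exp (-(Real.pi * lam * v))) *
        cellWeight lam β s θ (gridFloor m v) (lossFrom β (gridFloor m v + 1 / ((m : ℝ) + 1))) := by
  have hm0 : (0 : ℝ) < m + 1 := by positivity
  set a : ℕ → ℝ := fun k => (k : ℝ) / (m + 1)
  set b : ℕ → ℝ := fun k => ((k : ℝ) + 1) / (m + 1)
  have hab : ∀ k, a k ≤ b k := fun k => by simp only [a, b]; gcongr; linarith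
  have ha : ∀ k, 0 ≤ a k := fun k => by positivity
  have hgrid : ∀ k v, a k ≤ v → v < b k → gridFloor m v = a k := by
    intro k v h1 h2
    rw [gridFloor, floor_eq_of_mem_cell h1 h2]
  have hgrid' : ∀ k, a k + 1 / ((m : ℝ) + 1) = b k := fun k => by simp only [a, b, add_div]
  have hfl : ∀ v, gridFloor m v = a ⌊((m : ℝ) + 1) * v⌋₊ := fun v => rfl
  have hcell : ∀ v, 0 ≤ v → a ⌊((m : ℝ) + 1) * v⌋₊ ≤ v ∧ v < b ⌊((m : ℝ) + 1) * v⌋₊ := by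
    intro v hv
    refine ⟨gridFloor_le m hv, ?_⟩
    rw [← hgrid']
    exact lt_gridFloor_add m v
  -- the cells partition the half line
  have hdisj : Pairwise (Function.onFun Disjoint fun k => Ico (a k) (b k)) := by
    intro k l hkl
    refine Set.disjoint_left.2 fun v h1 h2 => hkl ?_
    exact (floor_eq_of_mem_cell h1.1 h1.2).symm.trans (floor_eq_of_mem_cell h2.1 h2.2)
  have hcover : ⋃ k, Ico (a k) (b k) = Ici 0 := by
    ext v
    simp only [mem_iUnion, mem_Ici]
    exact ⟨fun ⟨k, hk⟩ => (ha k).trans hk.1, fun hv => ⟨_, hcell v hv⟩⟩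
  rw [← hcover, lintegral_iUnion (fun k => measurableSet_Ico) hdisj]
  -- the events that the nearest point lies in a given cell partition the sample space
  have hVmem : ∀ᵐ ω ∂μ, ∀ k, ω ∈ nearestCell X (a k) (b k) ↔ a k ≤ V ω ∧ V ω < b k := by
    filter_upwards [hV] with ω hω k
    obtain ⟨h1, i, hi⟩ := hω
    constructor
    · rintro ⟨h3, j, hj⟩
      exact ⟨hi ▸ h3 i, (h1 j).trans_lt hj⟩
    · rintro ⟨h3, h4⟩
      exact ⟨fun j => h3.trans (h1 j), i, hi ▸ h4⟩
  have hdisjΩ : Pairwise (Function.onFun Disjoint fun k => nearestCell X (a k) (b k)) := by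
    intro k l hkl
    refine Set.disjoint_left.2 fun ω h1 h2 => ?_
    have key : ∀ k l, k < l → ω ∈ nearestCell X (a k) (b k) → ω ∈ nearestCell X (a l) (b l) →
        False := by
      intro k l hkl h1 h2
      obtain ⟨i, hi⟩ := h1.2
      have h3 := h2.1 i
      have : b k ≤ a l := by
        simp only [a, b]
        have : (k : ℝ) + 1 ≤ l := by exact_mod_cast hkl
        gcongr
      linarith
    rcases lt_or_gt_of_ne hkl with h | h
    · exact key _ _ h h1 h2
    · exact key _ _ h h2 h1
  have hcoverΩ : ∀ᵐ ω ∂μ, ω ∈ ⋃ k, nearestCell X (a k) (b k) := by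
    filter_upwards [hV, hVmem] with ω h1 h2
    obtain ⟨i, hi⟩ := h1.2
    have h0 : 0 ≤ V ω := hi ▸ by positivity
    exact mem_iUnion.2 ⟨_, (h2 _).2 (hcell _ h0)⟩
  rw [← Measure.restrict_eq_self_of_ae_mem hcoverΩ,
    lintegral_iUnion (fun k => measurableSet_nearestCell hX.measurable _ _) hdisjΩ]
  refine tsum_congr fun k => ?_
  set f : ℝ → ℝ≥0∞ := fun u => ENNReal.ofReal θ * ENNReal.ofReal (a k ^ β) * lossFrom β (b k) u
  have hf : Measurable f := (measurable_lossFrom β (b k)).const_mul _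
  have h1 : ∫⁻ v in Ico (a k) (b k),
      ENNReal.ofReal (Real.pi * lam * Real.exp (-(Real.pi * lam * v))) *
        cellWeight lam β s θ (gridFloor m v) (lossFrom β (gridFloor m v + 1 / ((m : ℝ) + 1))) =
      (∫⁻ v in Ico (a k) (b k), ENNReal.ofReal (Real.pi * lam * Real.exp (-(Real.pi * lam * v)))) *
        cellWeight lam β s θ (a k) (lossFrom β (b k)) := by
    rw [← lintegral_mul_const _ (by fun_prop)]
    refine setLIntegral_congr_fun measurableSet_Ico fun v hv => ?_
    simp only [hgrid k v hv.1 hv.2, hgrid']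
  have h2 : ∫⁻ ω in nearestCell X (a k) (b k), nexp (ENNReal.ofReal θ *
        gridInvSnr m β s (V ω) (fun i => X i ω) (fun i => g i ω)) ∂μ =
      ∫⁻ ω in nearestCell X (a k) (b k),
        nexp (ENNReal.ofReal θ * (ENNReal.ofReal (a k ^ β) * ENNReal.ofReal s)) *
        nexp (∑' i, ENNReal.ofReal (g i ω) * f (‖X i ω‖ ^ 2)) ∂μ := by
    refine setLIntegral_congr_fun_ae (measurableSet_nearestCell hX.measurable _ _) ?_
    filter_upwards [hVmem] with ω h1 h2
    obtain ⟨h3, h4⟩ := (h1 k).1 h2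
    rw [← nexp_add, gridInvSnr, hgrid k _ h3 h4, hgrid', mul_add, mul_add, ← ENNReal.tsum_mul_left,
      ← ENNReal.tsum_mul_left]
    congr 2
    refine tsum_congr fun i => ?_
    simp only [f]
    ring
  have hmeas : Measurable fun ω => nexp (∑' i, ENNReal.ofReal (g i ω) * f (‖X i ω‖ ^ 2)) := by
    refine measurable_nexp.comp (Measurable.tsum fun i => ?_)
    exact (hg.measurable i).ennreal_ofReal.mul (hf.comp ((hX.measurable i).norm.pow_const 2))
  rw [h1, h2, lintegral_const_mul _ hmeas, hX.setLIntegral_nearestCell hlam hg hXg hf (ha k) (hab k)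
    (fun u hu => by simp [f, lossFrom_eq_zero hu]), cellWeight]
  ring

/-- The Laplace transform of `invSnr` at the squared distance of the nearest point. -/
theorem IsHomogeneousPPP.lintegral_invSnr (hX : IsHomogeneousPPP μ lam X) (hlam : 0 < lam)
    (hg : IsIIDExp μ g) (hXg : IndepFun (fun ω i => X i ω) (fun ω i => g i ω) μ) (hβ : 1 < β)
    (s θ : ℝ) {V : Ω → ℝ} (hVm : Measurable V)
    (hV : ∀ᵐ ω ∂μ, (∀ i, V ω ≤ ‖X i ω‖ ^ 2) ∧ ∃ i, V ω = ‖X i ω‖ ^ 2) :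
    ∫⁻ ω, nexp (ENNReal.ofReal θ * invSnr β s (V ω) (fun i => X i ω) (fun i => g i ω)) ∂μ =
      ∫⁻ v in Ioi 0, ENNReal.ofReal (Real.pi * lam * Real.exp (-(Real.pi * lam * v))) *
        cellWeight lam β s θ v (lossBeyond β v) := by
  have hβ0 : 0 ≤ β := by linarith
  have hpow : ∀ v, 0 ≤ v → Tendsto (fun m => ENNReal.ofReal (gridFloor m v ^ β)) atTop
      (𝓝 (ENNReal.ofReal (v ^ β))) := fun v hv =>
    ENNReal.tendsto_ofReal ((tendsto_gridFloor hv).rpow_const (Or.inr hβ0))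
  have hL : Tendsto (fun m => ∫⁻ ω, nexp (ENNReal.ofReal θ *
        gridInvSnr m β s (V ω) (fun i => X i ω) (fun i => g i ω)) ∂μ) atTop
      (𝓝 (∫⁻ ω, nexp (ENNReal.ofReal θ *
        invSnr β s (V ω) (fun i => X i ω) (fun i => g i ω)) ∂μ)) := by
    refine tendsto_lintegral_of_dominated_convergence (fun _ => 1) (fun m => ?_)
      (fun n => Eventually.of_forall fun ω => nexp_le_one _) (by simp) ?_
    · refine measurable_nexp.comp (Measurable.const_mul ?_ _)
      have hgV : Measurable fun ω => gridFloor m (V ω) := (measurable_gridFloor m).comp hVm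
      refine Measurable.mul (by fun_prop) (Measurable.const_add (Measurable.tsum fun i => ?_) _)
      refine (hg.measurable i).ennreal_ofReal.mul ?_
      have hn : Measurable fun ω => ‖X i ω‖ ^ 2 := (hX.measurable i).norm.pow_const 2
      exact Measurable.ite (measurableSet_le (hgV.add_const _) hn) (by fun_prop) measurable_const
    · filter_upwards [hV, hX.ae_tsum_lossBeyond_ne_top hlam.le hg hXg hβ] with ω h1 h2
      have h0 : 0 ≤ V ω := by
        obtain ⟨i, hi⟩ := h1.2
        rw [hi]; positivity
      refine (continuous_nexp.tendsto _).comp (ENNReal.Tendsto.const_mul ?_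
        (Or.inr ENNReal.ofReal_ne_top))
      -- All grid cut-offs exceed `V ω`, so the series with cut-off `V ω`, which is finite,
      -- dominates.
      have hsum : Tendsto (fun m => ∑' i, ENNReal.ofReal (g i ω) *
          lossFrom β (gridFloor m (V ω) + 1 / ((m : ℝ) + 1)) (‖X i ω‖ ^ 2)) atTop
          (𝓝 (∑' i, ENNReal.ofReal (g i ω) * lossBeyond β (V ω) (‖X i ω‖ ^ 2))) := by
        simp_rw [← lintegral_count]
        refine tendsto_lintegral_of_dominated_convergence
          (fun i => ENNReal.ofReal (g i ω) * lossBeyond β (V ω) (‖X i ω‖ ^ 2))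
          (fun m => measurable_from_top) (fun m => Eventually.of_forall fun i => ?_) ?_
          (Eventually.of_forall fun i => ?_)
        · beta_reduce
          gcongr
          exact lossFrom_le_lossBeyond (lt_gridFloor_add m _)
        · rw [lintegral_count]; exact h2 _
        · exact ENNReal.Tendsto.const_mul (tendsto_lossFrom (tendsto_gridFloor_add h0)
            (fun m => lt_gridFloor_add m _)) (Or.inr ENNReal.ofReal_ne_top)
      exact ENNReal.Tendsto.mul (hpow _ h0) (Or.inr (ENNReal.add_ne_top.2
        ⟨ENNReal.ofReal_ne_top, h2 _⟩)) (tendsto_const_nhds.add hsum) (Or.inr ENNReal.ofReal_ne_top)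
  refine tendsto_nhds_unique hL ?_
  -- The point `v = 0` is discarded, since the majorant `lossBeyond β v` is integrable only for `v >
  -- 0`.
  simp_rw [hX.lintegral_gridInvSnr hlam hg hXg s θ _ hV, ← restrict_Ioi_eq_restrict_Ici]
  refine tendsto_lintegral_of_dominated_convergence'
    (fun v => ENNReal.ofReal (Real.pi * lam * Real.exp (-(Real.pi * lam * v)))) (fun m => ?_)
    (fun m => Eventually.of_forall fun v => ?_) ?_ ?_
  · refine Measurable.aemeasurable (Measurable.mul (by fun_prop) ?_)
    -- The cell weight depends on `v` only through the integer `⌊(m + 1) v⌋₊`, so its measurability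
    -- is automatic.
    have hk : Measurable fun k : ℕ => cellWeight lam β s θ ((k : ℝ) / ((m : ℝ) + 1))
        (lossFrom β ((k : ℝ) / ((m : ℝ) + 1) + 1 / ((m : ℝ) + 1))) := measurable_from_top
    exact hk.comp ((Nat.measurable_floor).comp (by fun_prop : Measurable fun v : ℝ => ((m : ℝ) + 1) * v))
  · exact mul_le_of_le_one_right' (cellWeight_le_one _ _ _ _ _ _)
  · refine (IntegrableOn.setLIntegral_lt_top ?_).ne
    have := (integrableOn_exp_mul_Ioi (by have := Real.pi_pos; nlinarith : -(Real.pi * lam) < 0) 0)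
    simpa [neg_mul, IntegrableOn] using this.const_mul (Real.pi * lam)
  · filter_upwards [ae_restrict_mem measurableSet_Ioi] with v hv
    have hv : 0 < v := hv
    refine ENNReal.Tendsto.const_mul ?_ (Or.inr ENNReal.ofReal_ne_top)
    refine ENNReal.Tendsto.mul ((continuous_nexp.tendsto _).comp ?_) (Or.inr (nexp_ne_top _))
      ((continuous_nexp.tendsto _).comp ?_) (Or.inr (nexp_ne_top _))
    · exact ENNReal.Tendsto.const_mul (ENNReal.Tendsto.mul_const (hpow v hv.le)
        (Or.inr ENNReal.ofReal_ne_top)) (Or.inr ENNReal.ofReal_ne_top)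
    · refine ENNReal.Tendsto.const_mul (ENNReal.Tendsto.const_mul ?_
        (Or.inr ENNReal.ofReal_ne_top)) (Or.inr ENNReal.ofReal_ne_top)
      refine tendsto_lintegral_of_dominated_convergence
        (fun u => ENNReal.ofReal θ * ENNReal.ofReal (v ^ β) * lossBeyond β v u) (fun m => ?_)
        (fun m => Eventually.of_forall fun u => ?_) ?_ (Eventually.of_forall fun u => ?_)
      · exact measurable_const.sub ((measurable_const.add
          ((measurable_lossFrom β _).const_mul _)).inv)
      · refine (one_sub_inv_one_add_le _).trans ?_
        beta_reduce
        gcongr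
        · exact gridFloor_nonneg _ _
        · exact gridFloor_le m hv.le
        · exact lossFrom_le_lossBeyond (lt_gridFloor_add m _)
      · rw [lintegral_const_mul _ (measurable_lossBeyond β v)]
        exact ENNReal.mul_ne_top (ENNReal.mul_ne_top ENNReal.ofReal_ne_top ENNReal.ofReal_ne_top)
          (lintegral_lossBeyond_ne_top hβ hv)
      · refine ENNReal.Tendsto.sub tendsto_const_nhds (Tendsto.inv ?_) (Or.inl ENNReal.one_ne_top)
        refine tendsto_const_nhds.add (ENNReal.Tendsto.mul
          (ENNReal.Tendsto.const_mul (hpow v hv.le) (Or.inr ENNReal.ofReal_ne_top)) (Or.inr ?_)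
          (tendsto_lossFrom (tendsto_gridFloor_add hv.le) (fun m => lt_gridFloor_add m _))
          (Or.inr (ENNReal.mul_ne_top ENNReal.ofReal_ne_top ENNReal.ofReal_ne_top)))
        unfold lossBeyond
        split_ifs <;> simp

end LaplaceTransform


/-! ### The function `rho` and the integrals of the rate formula -/

section Rho

variable {α : ℝ}

lemma integrableOn_inv_one_add_rpow {β a : ℝ} (hβ : 1 < β) (ha : 0 < a) :
    IntegrableOn (fun u : ℝ => 1 / (1 + u ^ β)) (Ioi a) := by
  refine (integrableOn_Ioi_rpow_of_lt (by linarith : -β < -1) ha).mono'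
    (Measurable.aestronglyMeasurable (by fun_prop)) ?_
  filter_upwards [ae_restrict_mem measurableSet_Ioi] with u hu
  have hu : 0 < u := ha.trans hu
  rw [Real.rpow_neg hu.le, Real.norm_of_nonneg (by positivity), one_div]
  gcongr
  linarith

lemma rho_nonneg {θ : ℝ} (hθ : 0 ≤ θ) : 0 ≤ rho θ α := by
  refine mul_nonneg (by positivity) (setIntegral_nonneg measurableSet_Ioi fun u hu => ?_)
  have : 0 < u := lt_of_le_of_lt (by positivity) hu
  positivity

lemma measurable_rho : Measurable fun θ => rho θ α := by
  have h : ∀ θ, rho θ α = θ ^ (2 / α) *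
      ∫ u, if θ ^ (-(2 / α)) < u then 1 / (1 + u ^ (α / 2)) else 0 := by
    intro θ
    rw [rho, ← integral_indicator measurableSet_Ioi]
    rfl
  simp_rw [h]
  refine Measurable.mul (by fun_prop) (StronglyMeasurable.measurable ?_)
  refine StronglyMeasurable.integral_prod_right' (f := fun q : ℝ × ℝ =>
    if q.1 ^ (-(2 / α)) < q.2 then 1 / (1 + q.2 ^ (α / 2)) else 0) ?_
  exact (Measurable.ite (measurableSet_lt (by fun_prop) (by fun_prop)) (by fun_prop)
    measurable_const).stronglyMeasurable

/-- Growth of `rho` from below, needed for integrability in `t`. For `θ ≥ 1` the integrand is at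
least 1/2 on `(θ^(-2/α), 1]`, whence `rho θ α ≥ (θ^(2/α) - 1) / 2`; for `θ ≤ 1` the left side is at
most 2. The constant 3 is not sharp. -/
lemma rpow_one_add_le (hα : 2 < α) {θ : ℝ} (hθ : 0 ≤ θ) :
    (1 + θ) ^ (2 / α) ≤ 3 * (1 + rho θ α) := by
  have hp0 : 0 ≤ 2 / α := by positivity
  have hp1 : 2 / α ≤ 1 := by rw [div_le_one (by linarith)]; linarith
  have h1 : (1 + θ) ^ (2 / α) ≤ 1 + θ ^ (2 / α) := by
    have := Real.rpow_add_le_add_rpow zero_le_one hθ hp0 hp1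
    simpa using this
  have hρ := rho_nonneg (α := α) hθ
  rcases le_total θ 1 with h | h
  · have := Real.rpow_le_one hθ h hp0
    linarith
  · have hθ0 : 0 < θ := by linarith
    set c := θ ^ (-(2 / α)) with hc
    have hc0 : 0 < c := by positivity
    have hc1 : c ≤ 1 := Real.rpow_le_one_of_one_le_of_nonpos h (by linarith)
    have h2 : (1 - c) / 2 ≤ ∫ u in Ioi c, 1 / (1 + u ^ (α / 2)) := by
      have h3 : ∫ u in Ioc c 1, (1 / 2 : ℝ) = (1 - c) / 2 := by
        rw [setIntegral_const, measureReal_def, Real.volume_Ioc, ENNReal.toReal_ofReal (by linarith)]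
        simp; ring
      rw [← h3]
      have hint := integrableOn_inv_one_add_rpow (by linarith : 1 < α / 2) hc0
      refine le_trans (setIntegral_mono_on (integrableOn_const (by simp))
        (hint.mono_set Ioc_subset_Ioi_self) measurableSet_Ioc fun u hu => ?_)
        (setIntegral_mono_set hint ?_ (Ioc_subset_Ioi_self.eventuallyLE))
      · have hu0 : 0 < u := hc0.trans hu.1
        have := Real.rpow_le_one hu0.le hu.2 (by positivity : 0 ≤ α / 2)
        gcongr
        linarith
      · filter_upwards [ae_restrict_mem measurableSet_Ioi] with u hu
        have : 0 < u := hc0.trans hu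
        simp only [Pi.zero_apply]
        positivity
    have h4 : θ ^ (2 / α) * ((1 - c) / 2) ≤ rho θ α := by
      rw [rho]; gcongr
    have h5 : θ ^ (2 / α) * c = 1 := by rw [hc, ← Real.rpow_add hθ0]; simp
    have h6 : 1 ≤ θ ^ (2 / α) := Real.one_le_rpow h hp0
    nlinarith

/-- Beyond `v` the integrand equals `1 / (1 + (u / K)^(α/2))` with `K = θ^(2/α) v`; rescaling by `K`
moves the lower limit `v` to `θ^(-2/α)`. -/
lemma lintegral_lossBeyond_eq_rho (hα : 2 < α) {θ v : ℝ} (hθ : 0 < θ) (hv : 0 < v) :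
    ∫⁻ u in Ioi 0, (1 - (1 + ENNReal.ofReal θ * ENNReal.ofReal (v ^ (α / 2)) *
      lossBeyond (α / 2) v u)⁻¹) = ENNReal.ofReal (v * rho θ α) := by
  set K := θ ^ (2 / α) * v with hK
  have hK0 : 0 < K := by positivity
  have hα0 : α ≠ 0 := by linarith
  have h1 : ∀ u, 1 - (1 + ENNReal.ofReal θ * ENNReal.ofReal (v ^ (α / 2)) *
      lossBeyond (α / 2) v u)⁻¹ =
      (Ioi v).indicator (fun u => ENNReal.ofReal (1 / (1 + (K⁻¹ * u) ^ (α / 2)))) u := by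
    intro u
    by_cases h : v < u
    · have hu : 0 < u := hv.trans h
      rw [indicator_of_mem (by exact h), lossBeyond, if_pos h, ← ENNReal.ofReal_mul hθ.le,
        ← ENNReal.ofReal_mul (by positivity), ← ENNReal.ofReal_one,
        ← ENNReal.ofReal_add zero_le_one (by positivity), ← ENNReal.ofReal_inv_of_pos (by positivity),
        ← ENNReal.ofReal_sub _ (by positivity)]
      congr 1
      have e1 : (K⁻¹ * u) ^ (α / 2) = u ^ (α / 2) / (θ * v ^ (α / 2)) := by
        rw [Real.mul_rpow (by positivity) hu.le, Real.inv_rpow hK0.le, hK,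
          Real.mul_rpow (by positivity) hv.le, ← Real.rpow_mul hθ.le]
        rw [show 2 / α * (α / 2) = 1 by field_simp, Real.rpow_one]
        field_simp
      rw [e1, Real.rpow_neg hu.le]
      have := Real.rpow_pos_of_pos hu (α / 2)
      have := Real.rpow_pos_of_pos hv (α / 2)
      field_simp
      ring
    · rw [indicator_of_notMem (by exact h), lossBeyond, if_neg h]
      simp
  have hvK : K⁻¹ * v = θ ^ (-(2 / α)) := by
    rw [hK, Real.rpow_neg hθ.le]; field_simp
  simp_rw [h1]
  rw [lintegral_indicator measurableSet_Ioi, Measure.restrict_restrict measurableSet_Ioi,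
    inter_eq_left.2 (Ioi_subset_Ioi hv.le), ← ofReal_integral_eq_lintegral_ofReal]
  · rw [integral_comp_mul_left_Ioi (fun u => 1 / (1 + u ^ (α / 2))) _ (by positivity), hvK, rho, inv_inv,
      smul_eq_mul, hK]
    congr 1
    ring
  · exact (integrableOn_Ioi_comp_mul_left_iff (fun u => 1 / (1 + u ^ (α / 2))) v
      (by positivity : 0 < K⁻¹)).2
      (integrableOn_inv_one_add_rpow (by linarith) (by positivity))
  · filter_upwards [ae_restrict_mem measurableSet_Ioi] with u hu
    have : 0 < u := hv.trans hu
    simp only [Pi.zero_apply]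
    positivity

/-- The exponential in the rate formula, as a function of `θ = k (e ^ t - 1)` and `v`. -/
noncomputable def rateExp (lamb P α σ2 θ v : ℝ) : ℝ :=
  Real.exp (-(Real.pi * lamb * v * (1 + rho θ α)) - θ * v ^ (α / 2) * (σ2 / P))

lemma rateIntegrand_eq (lamb P α σ2 : ℝ) (n : ℕ) (v t : ℝ) :
    rateIntegrand lamb P α σ2 n v t = ∑ k ∈ Finset.Icc 1 (n + 1),
      ((n + 1).choose k : ℝ) * (-1) ^ (k + 1) * rateExp lamb P α σ2 (k * (Real.exp t - 1)) v := by
  unfold rateIntegrand rateExp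
  refine Finset.sum_congr rfl fun k _ => ?_
  congr 3
  ring

lemma ofReal_mul_cellWeight {lam s θ v : ℝ} (hα : 2 < α) (hlam : 0 < lam) (hs : 0 ≤ s) (hθ : 0 < θ)
    (hv : 0 < v) :
    ENNReal.ofReal (Real.pi * lam * Real.exp (-(Real.pi * lam * v))) *
        cellWeight lam (α / 2) s θ v (lossBeyond (α / 2) v) =
      ENNReal.ofReal (Real.pi * lam * Real.exp (-(Real.pi * lam * v * (1 + rho θ α)) -
        θ * v ^ (α / 2) * s)) := by
  have hpi := Real.pi_pos
  have hρ := rho_nonneg (α := α) hθ.le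
  rw [cellWeight, lintegral_lossBeyond_eq_rho hα hθ hv, ← ENNReal.ofReal_mul hpi.le,
    ← ENNReal.ofReal_mul hlam.le, ← ENNReal.ofReal_mul (by positivity), ← ENNReal.ofReal_mul hθ.le,
    nexp_ofReal (by positivity), nexp_ofReal (by positivity), ← ENNReal.ofReal_mul (by positivity),
    ← ENNReal.ofReal_mul (by positivity)]
  congr 1
  rw [mul_assoc, ← Real.exp_add, ← Real.exp_add]
  congr 2
  ring

variable {lamb P σ2 : ℝ}

/-- Since `k ≥ 1`, `1 + k (e^t - 1) ≥ e^t`, and `rpow_one_add_le` gives the majorant `exp (-c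
e^{2t/α} v)`. Its integral over `v` is `c⁻¹ e^{-2t/α}`, which is integrable in `t`. -/
lemma integrableOn_rateExp (hlamb : 0 < lamb) (hP : 0 < P) (hα : 2 < α) (hσ2 : 0 ≤ σ2) {k : ℝ}
    (hk : 1 ≤ k) :
    IntegrableOn (fun p : ℝ × ℝ => rateExp lamb P α σ2 (k * (Real.exp p.2 - 1)) p.1)
      (Ioi 0 ×ˢ Ioi 0) := by
  have hpi := Real.pi_pos
  -- The 3 absorbs the constant of `rpow_one_add_le`.
  set c := Real.pi * lamb / 3 with hc
  have hc0 : 0 < c := by positivity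
  set p := 2 / α with hp
  have hp0 : 0 < p := by positivity
  have hdom : IntegrableOn (fun q : ℝ × ℝ => Real.exp (-(c * Real.exp (p * q.2)) * q.1))
      (Ioi 0 ×ˢ Ioi 0) := by
    rw [IntegrableOn, Measure.volume_eq_prod, ← Measure.prod_restrict,
      integrable_prod_iff' (by fun_prop)]
    constructor
    · refine Eventually.of_forall fun t => ?_
      have hneg : -(c * Real.exp (p * t)) < 0 := by have := Real.exp_pos (p * t); nlinarith
      exact integrableOn_exp_mul_Ioi hneg 0
    · have : ∀ t : ℝ, ∫ v in Ioi (0 : ℝ), ‖Real.exp (-(c * Real.exp (p * t)) * v)‖ =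
          c⁻¹ * Real.exp (-p * t) := by
        intro t
        simp_rw [Real.norm_eq_abs, Real.abs_exp]
        rw [integral_exp_mul_Ioi (by have := Real.exp_pos (p * t); nlinarith) 0]
        rw [mul_zero, Real.exp_zero, neg_mul, Real.exp_neg]
        field_simp
      simp_rw [this]
      exact (integrableOn_exp_mul_Ioi (by linarith : -p < 0) 0).const_mul _
  refine hdom.mono' ?_ ?_
  · have := measurable_rho (α := α)
    unfold rateExp
    exact Measurable.aestronglyMeasurable (by fun_prop)
  · filter_upwards [ae_restrict_mem (measurableSet_Ioi.prod measurableSet_Ioi)] with q hq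
    have hv : 0 < q.1 := hq.1
    have ht : 0 < q.2 := hq.2
    have hθ : 0 ≤ Real.exp q.2 - 1 := by have := Real.one_le_exp ht.le; linarith
    have h1 := rpow_one_add_le hα (by positivity : 0 ≤ k * (Real.exp q.2 - 1))
    have h2 : Real.exp (p * q.2) ≤ (1 + k * (Real.exp q.2 - 1)) ^ (2 / α) := by
      rw [mul_comm, Real.exp_mul]
      refine Real.rpow_le_rpow (Real.exp_pos _).le ?_ hp0.le
      nlinarith
    have h3 : 0 ≤ k * (Real.exp q.2 - 1) * q.1 ^ (α / 2) * (σ2 / P) := by positivity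
    rw [rateExp, Real.norm_eq_abs, Real.abs_exp]
    refine Real.exp_le_exp.2 ?_
    have h4 : c * Real.exp (p * q.2) * q.1 ≤
        c * (3 * (1 + rho (k * (Real.exp q.2 - 1)) α)) * q.1 := by
      gcongr
      exact h2.trans h1
    have h5 : c * (3 * (1 + rho (k * (Real.exp q.2 - 1)) α)) * q.1 =
        Real.pi * lamb * q.1 * (1 + rho (k * (Real.exp q.2 - 1)) α) := by rw [hc]; ring
    linarith

lemma integrableOn_rateIntegrand (hlamb : 0 < lamb) (hP : 0 < P) (hα : 2 < α) (hσ2 : 0 ≤ σ2)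
    (n : ℕ) :
    IntegrableOn (fun p : ℝ × ℝ => rateIntegrand lamb P α σ2 n p.1 p.2) (Ioi 0 ×ˢ Ioi 0) := by
  simp_rw [rateIntegrand_eq]
  refine integrable_finsetSum _ fun k hk => ?_
  exact (integrableOn_rateExp hlamb hP hα hσ2
    (by exact_mod_cast (Finset.mem_Icc.1 hk).1)).const_mul _

lemma integrableOn_rateExp_left (hlamb : 0 < lamb) (hP : 0 < P) (hσ2 : 0 ≤ σ2) {θ : ℝ}
    (hθ : 0 ≤ θ) : IntegrableOn (rateExp lamb P α σ2 θ) (Ioi 0) := by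
  have hpi := Real.pi_pos
  have hρ := rho_nonneg (α := α) hθ
  refine (integrableOn_exp_mul_Ioi (by nlinarith : -(Real.pi * lamb) < 0) 0).mono'
    (Measurable.aestronglyMeasurable (by unfold rateExp; fun_prop)) ?_
  filter_upwards [ae_restrict_mem measurableSet_Ioi] with v hv
  have hv : 0 < v := hv
  rw [rateExp, Real.norm_eq_abs, Real.abs_exp]
  refine Real.exp_le_exp.2 ?_
  have h1 : 0 ≤ θ * v ^ (α / 2) * (σ2 / P) := by positivity
  have h2 : 0 ≤ Real.pi * lamb * v * rho θ α := by positivity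
  linarith

end Rho


/-! ### Maxima of independent exponential variables -/

lemma maxGain_le_iff {x : ℕ → ℝ} {n : ℕ} {y : ℝ} : maxGain x n ≤ y ↔ ∀ i ≤ n, x i ≤ y := by
  simp [maxGain, Finset.sup'_le_iff]

lemma le_maxGain {x : ℕ → ℝ} {n i : ℕ} (hi : i ≤ n) : x i ≤ maxGain x n :=
  maxGain_le_iff.1 le_rfl i hi

lemma exists_eq_maxGain (x : ℕ → ℝ) (n : ℕ) : ∃ i ≤ n, maxGain x n = x i := by
  obtain ⟨i, hi, h⟩ := Finset.exists_mem_eq_sup' Finset.nonempty_range_add_one x (s := Finset.range (n + 1))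
  exact ⟨i, Nat.lt_succ_iff.1 (Finset.mem_range.1 hi), h⟩

lemma measurable_maxGain (n : ℕ) : Measurable fun x : ℕ → ℝ => maxGain x n := by
  unfold maxGain
  exact Finset.measurable_range_sup'' fun i _ => measurable_pi_apply i

lemma maxGain_comp_perm (x : ℕ → ℝ) {n : ℕ} (σ : Equiv.Perm ℕ) (hσ : ∀ i, σ i ≤ n ↔ i ≤ n) :
    maxGain (fun i => x (σ i)) n = maxGain x n := by
  refine le_antisymm (maxGain_le_iff.2 fun i hi => le_maxGain ((hσ i).2 hi))
    (maxGain_le_iff.2 fun i hi => ?_)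
  have := le_maxGain (x := fun i => x (σ i)) (n := n) (i := σ.symm i) ((hσ _).1 (by simpa using hi))
  simpa using this

/-- Tail `P(max > y)` of the maximum of `n + 1` independent unit-mean exponentials. -/
noncomputable def maxTail (n : ℕ) (y : ℝ) : ℝ := 1 - (1 - Real.exp (-y)) ^ (n + 1)

lemma measurable_maxTail (n : ℕ) : Measurable (maxTail n) := by
  unfold maxTail; fun_prop

lemma maxTail_nonneg (n : ℕ) {y : ℝ} (hy : 0 ≤ y) : 0 ≤ maxTail n y := by
  have h1 : Real.exp (-y) ≤ 1 := Real.exp_le_one_iff.2 (by linarith)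
  have := pow_le_one₀ (n := n + 1) (by linarith : 0 ≤ 1 - Real.exp (-y))
    (by have := Real.exp_pos (-y); linarith)
  unfold maxTail; linarith

/-- Bernoulli's inequality, in effect the union bound. Linear growth in `n` is enough because `N`
has finite mean. -/
lemma maxTail_le (n : ℕ) {y : ℝ} (hy : 0 ≤ y) : maxTail n y ≤ (n + 1) * maxTail 0 y := by
  have h1 : Real.exp (-y) ≤ 1 := Real.exp_le_one_iff.2 (by linarith)
  have := one_add_mul_le_pow (a := -Real.exp (-y)) (by linarith) (n + 1)
  push_cast at this
  simp only [maxTail, zero_add, pow_one]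
  rw [← sub_eq_add_neg] at this
  linarith

/-- Binomial expansion: the term `k = 0` cancels the leading 1, and the minus sign turns `(-1)^k`
into `(-1)^(k+1)`. -/
lemma maxTail_eq_sum (n : ℕ) (y : ℝ) :
    maxTail n y = ∑ k ∈ Finset.Icc 1 (n + 1),
      ((n + 1).choose k : ℝ) * (-1) ^ (k + 1) * Real.exp (-(k * y)) := by
  have h := add_pow (-Real.exp (-y)) 1 (n + 1)
  rw [Finset.range_eq_Ico, Finset.sum_eq_sum_Ico_succ_bot (by omega)] at h
  have hI : Finset.Ico (0 + 1) (n + 1 + 1) = Finset.Icc 1 (n + 1) := by ext; simp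
  rw [hI] at h
  rw [maxTail, sub_eq_neg_add 1 (Real.exp (-y)), h]
  simp only [pow_zero, one_pow, mul_one, Nat.choose_zero_right, Nat.cast_one]
  rw [sub_add_cancel_left, ← Finset.sum_neg_distrib]
  refine Finset.sum_congr rfl fun k _ => ?_
  rw [neg_pow, ← Real.exp_nat_mul, pow_succ]
  rw [mul_neg]
  ring

section Maximum

variable {Ω : Type*} [MeasurableSpace Ω] {μ : Measure Ω} [IsProbabilityMeasure μ]
  {h : ℕ → Ω → ℝ}

lemma IsIIDExp.measurable_seq {μ : Measure Ω} (hh : IsIIDExp μ h) : Measurable fun ω i => h i ω :=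
  measurable_pi_lambda _ hh.measurable

lemma IsIIDExp.measure_lt_maxGain (hh : IsIIDExp μ h) (n : ℕ) {y : ℝ} (hy : 0 ≤ y) :
    μ {ω | y < maxGain (fun i => h i ω) n} = ENNReal.ofReal (maxTail n y) := by
  have := isProbabilityMeasure_expMeasure one_pos
  have h1 : ∀ i, μ (h i ⁻¹' Iic y) = ENNReal.ofReal (1 - Real.exp (-y)) := by
    intro i
    rw [← Measure.map_apply (hh.measurable i) measurableSet_Iic, hh.law i, ← ofReal_measureReal,
      ← cdf_eq_real, cdf_expMeasure_eq one_pos, if_pos hy, one_mul]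
  have h2 : {ω | y < maxGain (fun i => h i ω) n} = (⋂ i ∈ Finset.range (n + 1), h i ⁻¹' Iic y)ᶜ := by
    ext ω
    rw [mem_compl_iff, mem_ofPred_eq, ← not_le, maxGain_le_iff]
    simp
  have hexp : 0 ≤ 1 - Real.exp (-y) := by
    have : Real.exp (-y) ≤ 1 := Real.exp_le_one_iff.2 (by linarith)
    linarith
  rw [h2, prob_compl_eq_one_sub (Finset.measurableSet_biInter _ fun i _ =>
    hh.measurable i measurableSet_Iic), hh.indep.measure_inter_preimage_eq_mul _
      (fun i _ => measurableSet_Iic)]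
  simp_rw [h1]
  rw [Finset.prod_const, Finset.card_range, ← ENNReal.ofReal_pow hexp, ← ENNReal.ofReal_one,
    ← ENNReal.ofReal_sub _ (by positivity), maxTail]

/-- With `h i` frozen, the law of `h j` has no atoms. This is what makes the best user unique. -/
lemma IsIIDExp.ae_ne (hh : IsIIDExp μ h) : ∀ᵐ ω ∂μ, ∀ i j, i ≠ j → h i ω ≠ h j ω := by
  rw [ae_all_iff]; intro i
  rw [ae_all_iff]; intro j
  by_cases hij : i = j
  · exact Eventually.of_forall fun ω h => absurd hij h
  have hpt : ∀ x : ℝ, μ {ω | h j ω = x} = 0 := by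
    intro x
    have h1 : μ (h j ⁻¹' {x}) = 0 := by
      rw [← Measure.map_apply (hh.measurable j) (measurableSet_singleton x), hh.law j]
      exact withDensity_absolutelyContinuous _ _ (by simp)
    exact h1
  have h2 := lintegral_comp_of_indepFun (hh.indep.indepFun hij) (hh.measurable i) (hh.measurable j)
    (F := fun x y => {q : ℝ × ℝ | q.2 = q.1}.indicator 1 (x, y))
    (measurable_one.indicator (measurableSet_eq_fun measurable_snd measurable_fst))
  have hset : ∀ ω, MeasurableSet {ω' | h j ω' = h i ω} := fun ω =>
    hh.measurable j (measurableSet_singleton _)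
  have h3 : ∫⁻ ω, {ω | h j ω = h i ω}.indicator 1 ω ∂μ =
      ∫⁻ ω, ∫⁻ ω', {ω' | h j ω' = h i ω}.indicator 1 ω' ∂μ ∂μ := h2
  rw [lintegral_indicator_one (measurableSet_eq_fun (hh.measurable j) (hh.measurable i))] at h3
  simp_rw [lintegral_indicator_one (hset _), hpt, lintegral_zero] at h3
  have h4 : ∀ᵐ ω ∂μ, ¬ h j ω = h i ω := by
    rw [ae_iff]; simpa using h3
  filter_upwards [h4] with ω hω _ h
  exact hω h.symm

/-- Both sides are the same infinite product of identical laws. -/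
lemma IsIIDExp.map_perm (hh : IsIIDExp μ h) (σ : Equiv.Perm ℕ) :
    μ.map (fun ω i => h (σ i) ω) = μ.map (fun ω i => h i ω) := by
  have h1 := (iIndepFun_iff_map_fun_eq_infinitePi_map hh.measurable).1 hh.indep
  have h2 := (iIndepFun_iff_map_fun_eq_infinitePi_map (fun i => hh.measurable (σ i))).1
    (hh.indep.precomp σ.injective)
  rw [h1, h2]
  simp_rw [hh.law]

variable {W : Ω → ℝ}

/-- Rates with the maximum of `n + 1` gains: layer-cake formula. -/
lemma IsIIDExp.lintegral_log_maxGain (hh : IsIIDExp μ h) (hW : Measurable W)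
    (hW0 : ∀ᵐ ω ∂μ, 0 < W ω) (hWh : IndepFun W (fun ω i => h i ω) μ) (n : ℕ) :
    ∫⁻ ω, ENNReal.ofReal (Real.log (1 + maxGain (fun i => h i ω) n / W ω)) ∂μ =
      ∫⁻ t in Ioi 0, ∫⁻ ω, ENNReal.ofReal (maxTail n (W ω * (Real.exp t - 1))) ∂μ := by
  have hM : Measurable fun ω => maxGain (fun i => h i ω) n :=
    (measurable_maxGain n).comp hh.measurable_seq
  have hM0 : ∀ᵐ ω ∂μ, 0 < maxGain (fun i => h i ω) n := by
    filter_upwards [hh.ae_pos] with ω hω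
    exact (hω 0).trans_le (le_maxGain (x := fun i => h i ω) (Nat.zero_le n))
  rw [lintegral_eq_lintegral_meas_lt]
  · refine setLIntegral_congr_fun measurableSet_Ioi fun t ht => ?_
    have ht : 0 < t := ht
    have hx : 0 < Real.exp t - 1 := by have := Real.one_lt_exp_iff.2 ht; linarith
    -- The event is rewritten as a threshold on the maximum alone, so that with `W` frozen its
    -- probability is `maxTail`.
    have h1 : μ {ω | t < Real.log (1 + maxGain (fun i => h i ω) n / W ω)} =
        μ {ω | W ω * (Real.exp t - 1) < maxGain (fun i => h i ω) n} := by
      refine measure_congr ?_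
      filter_upwards [hM0, hW0] with ω h1 h2
      refine propext ?_
      change t < Real.log _ ↔ W ω * _ < _
      rw [Real.lt_log_iff_exp_lt (by positivity), ← sub_lt_iff_lt_add', lt_div_iff₀ h2, mul_comm]
    rw [h1]
    set F : ℝ → (ℕ → ℝ) → ℝ≥0∞ := fun w x =>
      {q : ℝ × (ℕ → ℝ) | q.1 * (Real.exp t - 1) < maxGain q.2 n}.indicator 1 (w, x)
    have hF : Measurable (Function.uncurry F) := measurable_one.indicator
      (measurableSet_lt (by fun_prop) ((measurable_maxGain n).comp measurable_snd))
    have h2 := lintegral_comp_of_indepFun hWh hW hh.measurable_seq hF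
    have h3 : ∫⁻ ω, F (W ω) (fun i => h i ω) ∂μ =
        μ {ω | W ω * (Real.exp t - 1) < maxGain (fun i => h i ω) n} := by
      rw [← lintegral_indicator_one (measurableSet_lt (hW.mul_const _) hM)]
      rfl
    rw [← h3, h2]
    refine lintegral_congr_ae ?_
    filter_upwards [hW0] with ω hω
    rw [← hh.measure_lt_maxGain n (by positivity : 0 ≤ W ω * (Real.exp t - 1)),
      ← lintegral_indicator_one (measurableSet_lt measurable_const hM)]
    rfl
  · filter_upwards [hM0, hW0] with ω h1 h2
    exact Real.log_nonneg (by have : 0 < maxGain (fun i => h i ω) n / W ω := by positivity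
                              linarith)
  · exact (Real.measurable_log.comp (measurable_const.add (hM.div hW))).aemeasurable

/-- `maxTail_le` under the layer-cake integral; it controls the series over `n`. -/
lemma IsIIDExp.lintegral_log_maxGain_le (hh : IsIIDExp μ h) (hW : Measurable W)
    (hW0 : ∀ᵐ ω ∂μ, 0 < W ω) (hWh : IndepFun W (fun ω i => h i ω) μ) (n : ℕ) :
    ∫⁻ ω, ENNReal.ofReal (Real.log (1 + maxGain (fun i => h i ω) n / W ω)) ∂μ ≤
      ENNReal.ofReal (n + 1) *
        ∫⁻ ω, ENNReal.ofReal (Real.log (1 + maxGain (fun i => h i ω) 0 / W ω)) ∂μ := by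
  rw [hh.lintegral_log_maxGain hW hW0 hWh, hh.lintegral_log_maxGain hW hW0 hWh,
    ← lintegral_const_mul' _ _ ENNReal.ofReal_ne_top]
  refine setLIntegral_mono' measurableSet_Ioi fun t ht => ?_
  rw [← lintegral_const_mul' _ _ ENNReal.ofReal_ne_top]
  refine lintegral_mono_ae ?_
  filter_upwards [hW0] with ω hω
  have hx : 0 ≤ Real.exp t - 1 := by have := Real.one_le_exp (le_of_lt ht); linarith
  rw [← ENNReal.ofReal_mul (by positivity)]
  exact ENNReal.ofReal_le_ofReal (maxTail_le n (by positivity))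

/-- Given that user `0` has the largest of `n + 1` exchangeable gains, its gain has the law of the
maximum. -/
lemma IsIIDExp.lintegral_top (hh : IsIIDExp μ h) (hW : Measurable W)
    (hWh : IndepFun W (fun ω i => h i ω) μ) (n : ℕ) {G : ℝ → ℝ → ℝ≥0∞}
    (hG : Measurable (Function.uncurry G)) :
    ((n : ℝ≥0∞) + 1) * ∫⁻ ω in {ω | ∀ j ≤ n, h j ω ≤ h 0 ω}, G (h 0 ω) (W ω) ∂μ =
      ∫⁻ ω, G (maxGain (fun i => h i ω) n) (W ω) ∂μ := by
  set F : ℕ → ℝ → (ℕ → ℝ) → ℝ≥0∞ := fun i w x =>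
    {q : ℝ × (ℕ → ℝ) | ∀ j ≤ n, q.2 j ≤ q.2 i}.indicator (fun q => G (maxGain q.2 n) q.1) (w, x)
    with hFdef
  have hset : ∀ i, MeasurableSet {q : ℝ × (ℕ → ℝ) | ∀ j ≤ n, q.2 j ≤ q.2 i} := by
    intro i
    have : {q : ℝ × (ℕ → ℝ) | ∀ j ≤ n, q.2 j ≤ q.2 i} = ⋂ j, ⋂ (_ : j ≤ n), {q | q.2 j ≤ q.2 i} := by
      ext; simp
    rw [this]
    exact MeasurableSet.iInter fun j => MeasurableSet.iInter fun _ =>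
      measurableSet_le (by fun_prop) (by fun_prop)
  have hF : ∀ i, Measurable (Function.uncurry (F i)) := fun i =>
    (hG.comp (((measurable_maxGain n).comp measurable_snd).prodMk measurable_fst)).indicator (hset i)
  have hFh : ∀ i, Measurable fun ω => F i (W ω) (fun j => h j ω) := fun i =>
    (hF i).comp (hW.prodMk hh.measurable_seq)
  -- Swapping users 0 and `i` preserves the law of the gains and their maximum, and exchanges the
  -- events that user 0 or user `i` is best.
  have hsymm : ∀ i ≤ n, ∫⁻ ω, F i (W ω) (fun j => h j ω) ∂μ =
      ∫⁻ ω, F 0 (W ω) (fun j => h j ω) ∂μ := by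
    intro i hi
    set σ := Equiv.swap 0 i with hσ
    have hσn : ∀ j, σ j ≤ n ↔ j ≤ n := by
      intro j
      rw [hσ, Equiv.swap_apply_def]
      split_ifs <;> omega
    have hσm : Measurable fun ω j => h (σ j) ω := measurable_pi_lambda _ fun j => hh.measurable _
    have h1 : ∀ w x, F i w (fun j => x (σ j)) = F 0 w x := by
      intro w x
      simp only [hFdef]
      have hiff : (w, fun j => x (σ j)) ∈ {q : ℝ × (ℕ → ℝ) | ∀ j ≤ n, q.2 j ≤ q.2 i} ↔
          (w, x) ∈ {q : ℝ × (ℕ → ℝ) | ∀ j ≤ n, q.2 j ≤ q.2 0} := by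
        simp only [mem_ofPred_eq]
        rw [show σ i = 0 by simp [hσ]]
        refine ⟨fun H j hj => ?_, fun H j hj => H _ ((hσn j).2 hj)⟩
        have := H (σ j) ((hσn j).2 hj)
        rwa [show σ (σ j) = j by simp [hσ]] at this
      by_cases hx : (w, x) ∈ {q : ℝ × (ℕ → ℝ) | ∀ j ≤ n, q.2 j ≤ q.2 0}
      · rw [indicator_of_mem hx, indicator_of_mem (hiff.2 hx)]
        simp only
        rw [maxGain_comp_perm x σ hσn]
      · rw [indicator_of_notMem hx, indicator_of_notMem (fun h => hx (hiff.1 h))]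
    rw [lintegral_comp_of_indepFun hWh hW hh.measurable_seq (hF i),
      lintegral_comp_of_indepFun hWh hW hh.measurable_seq (hF 0)]
    refine lintegral_congr fun ω => ?_
    have hFw : Measurable (F i (W ω)) := (hF i).comp measurable_prodMk_left
    simp_rw [← h1]
    rw [← lintegral_map hFw hh.measurable_seq, ← hh.map_perm σ, lintegral_map hFw hσm]
  -- Without ties exactly one user attains the maximum, so the `n + 1` equal contributions add up to
  -- the whole.
  have hsum : ∀ᵐ ω ∂μ, ∑ i ∈ Finset.range (n + 1), F i (W ω) (fun j => h j ω) =
      G (maxGain (fun i => h i ω) n) (W ω) := by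
    filter_upwards [hh.ae_ne] with ω hω
    obtain ⟨i, hi, hmax⟩ := exists_eq_maxGain (fun i => h i ω) n
    rw [Finset.sum_eq_single i]
    · have H : ∀ j ≤ n, h j ω ≤ h i ω :=
        fun j hj => hmax ▸ le_maxGain (x := fun i => h i ω) hj
      exact indicator_of_mem (by exact H) _
    · intro j hj hji
      refine indicator_of_notMem (fun H => ?_) _
      have H' : ∀ l ≤ n, h l ω ≤ h j ω := H
      have hj' : j ≤ n := Nat.lt_succ_iff.1 (Finset.mem_range.1 hj)
      exact hω j i hji (le_antisymm (hmax ▸ le_maxGain (x := fun i => h i ω) hj') (H' i hi))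
    · intro hi'
      exact absurd (Finset.mem_range.2 (Nat.lt_succ_iff.2 hi)) hi'
  have hS : MeasurableSet {ω | ∀ j ≤ n, h j ω ≤ h 0 ω} :=
    (hset 0).preimage (hW.prodMk hh.measurable_seq)
  have h0 : ∫⁻ ω in {ω | ∀ j ≤ n, h j ω ≤ h 0 ω}, G (h 0 ω) (W ω) ∂μ =
      ∫⁻ ω, F 0 (W ω) (fun j => h j ω) ∂μ := by
    rw [← lintegral_indicator hS]
    refine lintegral_congr fun ω => ?_
    by_cases H : ∀ j ≤ n, h j ω ≤ h 0 ω
    · rw [indicator_of_mem (by exact H), hFdef]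
      simp only
      rw [indicator_of_mem (by exact H)]
      simp only
      rw [le_antisymm (maxGain_le_iff.2 H) (le_maxGain (x := fun i => h i ω) (Nat.zero_le n))]
    · rw [indicator_of_notMem (by exact H), hFdef]
      simp only
      rw [indicator_of_notMem (by exact H)]
  rw [← lintegral_congr_ae hsum, lintegral_finsetSum _ fun i _ => hFh i, h0]
  rw [Finset.sum_congr rfl fun i hi => hsymm i (Nat.lt_succ_iff.1 (Finset.mem_range.1 hi))]
  simp

lemma lintegral_comp_nat_of_indepFun {β : Type*} [MeasurableSpace β] {f : Ω → β} {N : Ω → ℕ}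
    (hfN : IndepFun f N μ) (hf : Measurable f) (hN : Measurable N) {F : β → ℕ → ℝ≥0∞}
    (hF : ∀ n, Measurable fun x => F x n) :
    ∫⁻ ω, F (f ω) (N ω) ∂μ = ∑' n, μ {ω | N ω = n} * ∫⁻ ω, F (f ω) n ∂μ := by
  have hFm : Measurable (Function.uncurry F) := measurable_from_prod_countable_left hF
  rw [lintegral_comp_of_indepFun hfN hf hN hFm]
  have h1 : ∀ ω, ∫⁻ ω', F (f ω) (N ω') ∂μ = ∑' n, μ {ω | N ω = n} * F (f ω) n := by
    intro ω
    rw [← lintegral_map (f := F (f ω)) measurable_from_top hN, lintegral_countable']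
    refine tsum_congr fun n => ?_
    rw [Measure.map_apply hN (measurableSet_singleton n), mul_comm]
    rfl
  simp_rw [h1]
  have hFf : ∀ n, Measurable fun ω => F (f ω) n := fun n => (hF n).comp hf
  rw [lintegral_tsum fun n => ((hFf n).const_mul _).aemeasurable]
  exact tsum_congr fun n => lintegral_const_mul _ ((hF n).comp hf)

end Maximum


/-! ### The probability mass function of the number of users -/

lemma pmfN_pos {lamb lamu : ℝ} (hlamb : 0 < lamb) (hlamu : 0 < lamu) (n : ℕ) :
    0 < pmfN lamb lamu n := by
  have hc : (0 : ℝ) < cVor := by norm_num [cVor]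
  have h1 := Real.Gamma_pos_of_pos (by positivity : (0 : ℝ) < n + cVor + 1)
  have h2 := Real.Gamma_pos_of_pos (by positivity : (0 : ℝ) < n + 1)
  have h3 := Real.Gamma_pos_of_pos (by positivity : (0 : ℝ) < cVor + 1)
  unfold pmfN
  positivity

lemma pmfN_succ {lamb lamu : ℝ} (hlamb : 0 < lamb) (hlamu : 0 < lamu) (n : ℕ) :
    pmfN lamb lamu (n + 1) = pmfN lamb lamu n * ((n + cVor + 1) / (n + 1) *
      (lamu / (cVor * lamb) / (lamu / (cVor * lamb) + 1))) := by
  have hc : (0 : ℝ) < cVor := by norm_num [cVor]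
  have h2 := Real.Gamma_pos_of_pos (by positivity : (0 : ℝ) < n + 1)
  have h3 := Real.Gamma_pos_of_pos (by positivity : (0 : ℝ) < cVor + 1)
  set q := lamu / (cVor * lamb) with hqdef
  have hq : 0 < q := by positivity
  simp only [pmfN, ← hqdef]
  push_cast
  rw [show (n : ℝ) + 1 + cVor + 1 = (n + cVor + 1) + 1 by ring,
    Real.Gamma_add_one (by positivity : (n : ℝ) + cVor + 1 ≠ 0),
    Real.Gamma_add_one (by positivity : (n : ℝ) + 1 ≠ 0), pow_succ,
    Real.rpow_add_one (by positivity)]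
  have h4 := Real.rpow_pos_of_pos (by positivity : 0 < q + 1) (n + cVor + 1)
  field_simp

/-- Finiteness of the mean of `N + 1`: the ratio of consecutive terms tends to `q / (q + 1) < 1`. -/
lemma summable_succ_mul_pmfN {lamb lamu : ℝ} (hlamb : 0 < lamb) (hlamu : 0 < lamu) :
    Summable fun n : ℕ => ((n : ℝ) + 1) * pmfN lamb lamu n := by
  have hc : (0 : ℝ) < cVor := by norm_num [cVor]
  set q := lamu / (cVor * lamb) with hqdef
  have hq : 0 < q := by positivity
  have hpos : ∀ n : ℕ, 0 < ((n : ℝ) + 1) * pmfN lamb lamu n := fun n =>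
    mul_pos (by positivity) (pmfN_pos hlamb hlamu n)
  refine summable_of_ratio_test_tendsto_lt_one (l := q / (q + 1))
    (by rw [div_lt_one (by positivity)]; linarith) (Eventually.of_forall fun n => (hpos n).ne') ?_
  have hone := tendsto_one_div_add_atTop_nhds_zero_nat (𝕜 := ℝ)
  have hlim : Tendsto (fun n : ℕ => (1 + 1 / ((n : ℝ) + 1)) * (1 + cVor * (1 / ((n : ℝ) + 1))) *
      (q / (q + 1))) atTop (𝓝 ((1 + 0) * (1 + cVor * 0) * (q / (q + 1)))) :=
    ((hone.const_add 1).mul ((hone.const_mul cVor).const_add 1)).mul_const _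
  simp only [add_zero, mul_zero, one_mul] at hlim
  refine hlim.congr fun n => ?_
  rw [Real.norm_of_nonneg (hpos n).le, Real.norm_of_nonneg (hpos (n + 1)).le, pmfN_succ hlamb hlamu]
  have := pmfN_pos hlamb hlamu n
  rw [← hqdef]
  push_cast
  field_simp
  ring

/-! ### The rate as a double integral -/

section Rate

variable {Ω : Type*} [MeasurableSpace Ω] {μ : Measure Ω} [IsProbabilityMeasure μ]
  {h : ℕ → Ω → ℝ} {W : Ω → ℝ} {lamb P α σ2 : ℝ}

/-- Mean rate with the largest of `n + 1` gains, when the reciprocal signal-to-interference ratio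
`W` has the Laplace transform of the Poisson model. -/
lemma IsIIDExp.lintegral_log_maxGain_eq (hh : IsIIDExp μ h) (hW : Measurable W)
    (hW0 : ∀ᵐ ω ∂μ, 0 < W ω) (hWh : IndepFun W (fun ω i => h i ω) μ)
    (hlamb : 0 < lamb) (hP : 0 < P) (hα : 2 < α) (hσ2 : 0 ≤ σ2)
    (hlap : ∀ θ, 0 < θ → ∫⁻ ω, ENNReal.ofReal (Real.exp (-(θ * W ω))) ∂μ =
      ∫⁻ v in Ioi 0, ENNReal.ofReal (Real.pi * lamb * rateExp lamb P α σ2 θ v)) (n : ℕ) :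
    (0 ≤ Real.pi * lamb * ∫ v in Ioi (0 : ℝ), ∫ t in Ioi (0 : ℝ), rateIntegrand lamb P α σ2 n v t) ∧
    ∫⁻ ω, ENNReal.ofReal (Real.log (1 + maxGain (fun i => h i ω) n / W ω)) ∂μ =
      ENNReal.ofReal (Real.pi * lamb *
        ∫ v in Ioi (0 : ℝ), ∫ t in Ioi (0 : ℝ), rateIntegrand lamb P α σ2 n v t) := by
  have hpi := Real.pi_pos
  have hexp_int : ∀ θ, 0 ≤ θ → Integrable (fun ω => Real.exp (-(θ * W ω))) μ := by
    intro θ hθ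
    refine Integrable.of_bound (C := 1) (Measurable.aestronglyMeasurable (by fun_prop)) ?_
    filter_upwards [hW0] with ω hω
    rw [Real.norm_eq_abs, Real.abs_exp]
    exact Real.exp_le_one_iff.2 (by have : 0 ≤ θ * W ω := by positivity
                                    linarith)
  -- Real-valued integrals are needed here because the binomial sum alternates in sign.
  have hlap' : ∀ θ, 0 < θ → ∫ ω, Real.exp (-(θ * W ω)) ∂μ =
      Real.pi * lamb * ∫ v in Ioi 0, rateExp lamb P α σ2 θ v := by
    intro θ hθ
    have hm : Measurable (rateExp lamb P α σ2 θ) := by unfold rateExp; fun_prop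
    rw [← integral_const_mul, integral_eq_lintegral_of_nonneg_ae
      (Eventually.of_forall fun ω => (Real.exp_pos _).le)
      (Measurable.aestronglyMeasurable (by fun_prop)), hlap θ hθ,
      ← integral_eq_lintegral_of_nonneg_ae]
    · exact Eventually.of_forall fun v => mul_nonneg (by positivity) (Real.exp_pos _).le
    · exact (hm.const_mul _).aestronglyMeasurable
  set J : ℝ → ℝ := fun t => Real.pi * lamb * ∫ v in Ioi (0 : ℝ), rateIntegrand lamb P α σ2 n v t
  have hx : ∀ t : ℝ, 0 < t → 0 < Real.exp t - 1 := fun t ht => by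
    have := Real.one_lt_exp_iff.2 ht; linarith
  have hJ : ∀ t, 0 < t → ∫ ω, maxTail n (W ω * (Real.exp t - 1)) ∂μ = J t := by
    intro t ht
    have hk : ∀ k ∈ Finset.Icc 1 (n + 1), (0 : ℝ) < k := fun k hk => by
      have := (Finset.mem_Icc.1 hk).1
      positivity
    simp_rw [maxTail_eq_sum]
    have h1 : ∀ (k : ℕ) ω, Real.exp (-(k * (W ω * (Real.exp t - 1)))) =
        Real.exp (-((k * (Real.exp t - 1)) * W ω)) := fun k ω => by congr 2; ring
    simp_rw [h1]
    rw [integral_finsetSum _ fun k hk' => (hexp_int _ (mul_pos (hk k hk') (hx t ht)).le).const_mul _]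
    simp only [J, rateIntegrand_eq]
    rw [integral_finsetSum _ fun k hk' => (integrableOn_rateExp_left hlamb hP hσ2
      (mul_pos (hk k hk') (hx t ht)).le).const_mul _, Finset.mul_sum]
    refine Finset.sum_congr rfl fun k hk' => ?_
    rw [integral_const_mul, integral_const_mul, hlap' _ (mul_pos (hk k hk') (hx t ht))]
    ring
  -- Nonnegativity is invisible in the alternating sum; it holds because `J t` is a mean tail
  -- probability.
  have hJ0 : ∀ t, 0 < t → 0 ≤ J t := by
    intro t ht
    rw [← hJ t ht]
    refine integral_nonneg_of_ae ?_
    filter_upwards [hW0] with ω hω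
    exact maxTail_nonneg n (mul_pos hω (hx t ht)).le
  have hint := integrableOn_rateIntegrand hlamb hP hα hσ2 n
  rw [IntegrableOn, Measure.volume_eq_prod, ← Measure.prod_restrict] at hint
  have hJint : IntegrableOn J (Ioi 0) := hint.integral_prod_right.const_mul _
  have hswap : ∫ t in Ioi 0, J t =
      Real.pi * lamb * ∫ v in Ioi (0 : ℝ), ∫ t in Ioi (0 : ℝ), rateIntegrand lamb P α σ2 n v t := by
    simp only [J]
    rw [integral_const_mul,
      integral_integral_swap (f := fun v t => rateIntegrand lamb P α σ2 n v t) hint]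
  rw [← hswap]
  refine ⟨setIntegral_nonneg measurableSet_Ioi fun t ht => hJ0 t ht, ?_⟩
  rw [hh.lintegral_log_maxGain hW hW0 hWh, ofReal_integral_eq_lintegral_ofReal hJint
    ((ae_restrict_mem measurableSet_Ioi).mono fun t ht => hJ0 t ht)]
  refine setLIntegral_congr_fun measurableSet_Ioi fun t ht => ?_
  have ht : 0 < t := ht
  rw [← hJ t ht, ofReal_integral_eq_lintegral_ofReal]
  · refine Integrable.of_bound (C := 1)
      ((measurable_maxTail n).comp (by fun_prop)).aestronglyMeasurable ?_
    filter_upwards [hW0] with ω hω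
    have hy : 0 ≤ W ω * (Real.exp t - 1) := (mul_pos hω (hx t ht)).le
    rw [Real.norm_of_nonneg (maxTail_nonneg n hy), maxTail, sub_le_self_iff]
    have : Real.exp (-(W ω * (Real.exp t - 1))) ≤ 1 := Real.exp_le_one_iff.2 (by linarith)
    exact pow_nonneg (by linarith) _
  · filter_upwards [hW0] with ω hω
    exact maxTail_nonneg n (mul_pos hω (hx t ht)).le

/-- Conditioning on `N = n` and on user `0` having the largest of `n + 1` gains. -/
lemma IsIIDExp.lintegral_cond_top (hh : IsIIDExp μ h) (hW : Measurable W)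
    (hWh : IndepFun W (fun ω i => h i ω) μ) {N : Ω → ℕ} (hN : Measurable N)
    (hN' : IndepFun (fun ω => (W ω, fun i => h i ω)) N μ) {n : ℕ} (hn : μ {ω | N ω = n} ≠ 0) :
    μ {ω | N ω = n ∧ ∀ j ≤ n, h j ω ≤ h 0 ω} ≠ 0 ∧
    ∀ G : ℝ → ℝ → ℝ≥0∞, Measurable (Function.uncurry G) →
      ∫⁻ ω, G (h 0 ω) (W ω) ∂(cond μ {ω | N ω = n ∧ ∀ j ≤ n, h j ω ≤ h 0 ω}) =
        ∫⁻ ω, G (maxGain (fun i => h i ω) n) (W ω) ∂μ := by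
  set T : Set (ℝ × (ℕ → ℝ)) := {q | ∀ j ≤ n, q.2 j ≤ q.2 0} with hTdef
  have hT : MeasurableSet T := by
    have : T = ⋂ j, ⋂ (_ : j ≤ n), {q | q.2 j ≤ q.2 0} := by
      ext; simp [hTdef]
    rw [this]
    exact MeasurableSet.iInter fun j => MeasurableSet.iInter fun _ =>
      measurableSet_le (by fun_prop) (by fun_prop)
  set S := {ω | N ω = n ∧ ∀ j ≤ n, h j ω ≤ h 0 ω} with hSdef
  set E := {ω | ∀ j ≤ n, h j ω ≤ h 0 ω} with hEdef
  have hpair : Measurable fun ω => (W ω, fun i => h i ω) := hW.prodMk hh.measurable_seq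
  have hE : MeasurableSet E := hT.preimage hpair
  have hS : MeasurableSet S := (hN (measurableSet_singleton n)).inter hE
  -- Independence of `N` splits off `P(N = n)`; `lintegral_top` accounts for the factor `n + 1`.
  have key : ∀ G : ℝ → ℝ → ℝ≥0∞, Measurable (Function.uncurry G) →
      ((n : ℝ≥0∞) + 1) * ∫⁻ ω in S, G (h 0 ω) (W ω) ∂μ =
        μ {ω | N ω = n} * ∫⁻ ω, G (maxGain (fun i => h i ω) n) (W ω) ∂μ := by
    intro G hG
    set F : ℝ × (ℕ → ℝ) → ℕ → ℝ≥0∞ := fun q m =>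
      if m = n then T.indicator (fun q => G (q.2 0) q.1) q else 0 with hFdef
    have hF : ∀ m, Measurable fun q => F q m := by
      intro m
      by_cases hm : m = n
      · simp only [hFdef, if_pos hm]
        refine Measurable.indicator ?_ hT
        have hq : Measurable fun q : ℝ × (ℕ → ℝ) => (q.2 0, q.1) := by fun_prop
        exact hG.comp hq
      · simp only [hFdef, if_neg hm]
        exact measurable_const
    have h1 := lintegral_comp_nat_of_indepFun hN' hpair hN hF
    have h2 : ∫⁻ ω in S, G (h 0 ω) (W ω) ∂μ = ∫⁻ ω, F (W ω, fun i => h i ω) (N ω) ∂μ := by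
      rw [← lintegral_indicator hS]
      refine lintegral_congr fun ω => ?_
      by_cases hm : N ω = n
      · by_cases hω : ∀ j ≤ n, h j ω ≤ h 0 ω
        · rw [indicator_of_mem (show ω ∈ S from ⟨hm, hω⟩)]
          simp only [hFdef, if_pos hm]
          rw [indicator_of_mem (by exact hω)]
        · rw [indicator_of_notMem (fun H : ω ∈ S => hω H.2)]
          simp only [hFdef, if_pos hm]
          rw [indicator_of_notMem (by exact hω)]
      · rw [indicator_of_notMem (fun H : ω ∈ S => hm H.1)]
        simp only [hFdef, if_neg hm]
    have h3 : ∫⁻ ω, F (W ω, fun i => h i ω) n ∂μ = ∫⁻ ω in E, G (h 0 ω) (W ω) ∂μ := by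
      rw [← lintegral_indicator hE]
      refine lintegral_congr fun ω => ?_
      simp only [hFdef, if_true]
      rfl
    rw [h2, h1, tsum_eq_single n, h3, ← hh.lintegral_top hW hWh n hG]
    · ring
    · intro m hm
      simp [hFdef, hm]
  have hn1 : ((n : ℝ≥0∞) + 1) ≠ 0 := by simp
  have hn2 : ((n : ℝ≥0∞) + 1) ≠ ⊤ := by simp
  -- The choice `G = 1` gives the normalisation `P(S) = P(N = n) / (n + 1)`.
  have hSμ : ((n : ℝ≥0∞) + 1) * μ S = μ {ω | N ω = n} := by
    have := key (fun _ _ => 1) measurable_const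
    simpa using this
  have hS0 : μ S ≠ 0 := by
    intro h0
    rw [h0, mul_zero] at hSμ
    exact hn hSμ.symm
  refine ⟨hS0, fun G hG => ?_⟩
  have h4 : ∫⁻ ω in S, G (h 0 ω) (W ω) ∂μ =
      μ S * ∫⁻ ω, G (maxGain (fun i => h i ω) n) (W ω) ∂μ := by
    rw [← ENNReal.mul_right_inj hn1 hn2, key G hG, ← mul_assoc, hSμ]
  rw [ProbabilityTheory.cond, lintegral_smul_measure, h4, smul_eq_mul, ← mul_assoc,
    ENNReal.inv_mul_cancel hS0 (measure_ne_top μ S), one_mul]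

end Rate


/-! ### Measurability of the model -/

lemma measurable_nearestBS : Measurable nearestBS := by
  have hS : ∀ i : ℕ, MeasurableSet {x : ℕ → Plane | ∀ j, ‖x i‖ ≤ ‖x j‖} := by
    intro i
    rw [show {x : ℕ → Plane | ∀ j, ‖x i‖ ≤ ‖x j‖} = ⋂ j, {x | ‖x i‖ ≤ ‖x j‖} by ext; simp]
    exact MeasurableSet.iInter fun j => measurableSet_le (by fun_prop) (by fun_prop)
  refine measurable_of_Iic fun n => ?_
  -- Where no minimiser exists the `sInf` is 0, so such configurations belong to every one of these
  -- preimages.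
  have : nearestBS ⁻¹' Iic n = (⋃ i ≤ n, {x : ℕ → Plane | ∀ j, ‖x i‖ ≤ ‖x j‖}) ∪
      (⋃ i, {x : ℕ → Plane | ∀ j, ‖x i‖ ≤ ‖x j‖})ᶜ := by
    ext x
    simp only [mem_preimage, mem_Iic, mem_union, mem_iUnion, mem_compl_iff, exists_prop]
    change sInf {i | ∀ j, ‖x i‖ ≤ ‖x j‖} ≤ n ↔
      (∃ i ≤ n, ∀ j, ‖x i‖ ≤ ‖x j‖) ∨ ¬ ∃ i, ∀ j, ‖x i‖ ≤ ‖x j‖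
    by_cases hne : ∃ i, ∀ j, ‖x i‖ ≤ ‖x j‖
    · simp only [hne, not_true_eq_false, or_false]
      refine ⟨fun h => ⟨_, h, Nat.sInf_mem (s := {i | ∀ j, ‖x i‖ ≤ ‖x j‖}) hne⟩, ?_⟩
      rintro ⟨i, hi, h⟩
      exact (Nat.sInf_le (s := {i | ∀ j, ‖x i‖ ≤ ‖x j‖}) h).trans hi
    · have hempty : {i | ∀ j, ‖x i‖ ≤ ‖x j‖} = (∅ : Set ℕ) :=
        eq_empty_iff_forall_notMem.2 fun i hi => hne ⟨i, hi⟩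
      simp [hne, hempty]
  rw [this]
  exact (MeasurableSet.iUnion fun i => MeasurableSet.iUnion fun _ => hS i).union
    (MeasurableSet.iUnion hS).compl

attribute [local irreducible] nearestBS

lemma measurable_servingDist : Measurable servingDist := by
  have h : Measurable fun p : (ℕ → Plane) × ℕ => ‖p.1 p.2‖ :=
    measurable_from_prod_countable_left fun n => by fun_prop
  have h2 := h.comp (measurable_id.prodMk measurable_nearestBS)
  exact h2

lemma measurable_interference (P α : ℝ) :
    Measurable fun q : (ℕ → Plane) × (ℕ → ℝ) => interference P α q.1 q.2 := by
  unfold interference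
  refine Measurable.const_mul (Measurable.tsum fun i => ?_) _
  unfold interfererTerm
  refine Measurable.ite ?_ measurable_const (by fun_prop)
  have : Measurable fun q : (ℕ → Plane) × (ℕ → ℝ) => nearestBS q.1 :=
    measurable_nearestBS.comp measurable_fst
  exact measurableSet_eq_fun measurable_const this

/-- Reciprocal of the SINR for unit gain. -/
noncomputable def invSinr (P α σ2 : ℝ) (x : ℕ → Plane) (γ : ℕ → ℝ) : ℝ :=
  servingDist x ^ α * (σ2 + interference P α x γ) / P

lemma measurable_invSinr (P α σ2 : ℝ) :
    Measurable fun q : (ℕ → Plane) × (ℕ → ℝ) => invSinr P α σ2 q.1 q.2 := by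
  have h1 := measurable_interference P α
  have h2 : Measurable fun q : (ℕ → Plane) × (ℕ → ℝ) => servingDist q.1 :=
    measurable_servingDist.comp measurable_fst
  unfold invSinr
  fun_prop

/-- Separates the gain from a denominator that depends only on the stations and their fading. With
division by zero equal to zero it needs no positivity. -/
lemma sinr_eq_div (P α σ2 : ℝ) (x : ℕ → Plane) (γ : ℕ → ℝ) (gain : ℝ) :
    sinr P α σ2 x γ gain = gain / invSinr P α σ2 x γ := by
  have h : 0 ≤ servingDist x := norm_nonneg _
  rw [sinr, invSinr, Real.rpow_neg h]
  simp only [div_eq_mul_inv, mul_inv, inv_inv]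
  ring

/-! ### Pathwise description of the interference -/

section Pathwise

variable {x : ℕ → Plane} {γ : ℕ → ℝ} {P α σ2 : ℝ}

/-- The properties that a realisation of the network has almost surely. -/
structure IsRegular (α : ℝ) (x : ℕ → Plane) (γ : ℕ → ℝ) : Prop where
  nearestBS_le : ∀ j, ‖x (nearestBS x)‖ ≤ ‖x j‖
  norm_ne : ∀ i j, i ≠ j → ‖x i‖ ≠ ‖x j‖
  gain_pos : ∀ i, 0 < γ i
  servingDist_pos : 0 < servingDist x
  tsum_ne_top : ∑' i, ENNReal.ofReal (γ i) *
    lossBeyond (α / 2) (servingDist x ^ 2) (‖x i‖ ^ 2) ≠ ⊤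

namespace IsRegular

/-- The interference leaves out the serving station by its index, the Poisson computation by its
distance; without ties the two agree. -/
lemma ofReal_interfererTerm (hx : IsRegular α x γ) (i : ℕ) :
    0 ≤ interfererTerm α x γ i ∧ ENNReal.ofReal (interfererTerm α x γ i) =
      ENNReal.ofReal (γ i) * lossBeyond (α / 2) (servingDist x ^ 2) (‖x i‖ ^ 2) := by
  unfold interfererTerm lossBeyond servingDist
  by_cases hi : i = nearestBS x
  · rw [if_pos hi, ← hi]; simp
  · have hlt : ‖x (nearestBS x)‖ < ‖x i‖ :=
      lt_of_le_of_ne (hx.nearestBS_le i) (hx.norm_ne _ _ (Ne.symm hi))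
    have hγi := hx.gain_pos i
    rw [if_neg hi, if_pos (by gcongr)]
    refine ⟨by positivity, ?_⟩
    rw [ENNReal.ofReal_mul hγi.le, ← Real.rpow_natCast_mul (norm_nonneg _)]
    congr 4
    push_cast
    ring

lemma summable_interfererTerm (hx : IsRegular α x γ) : Summable (interfererTerm α x γ) := by
  have hfin := hx.tsum_ne_top
  have h := hx.ofReal_interfererTerm
  simp_rw [← (h _).2] at hfin
  refine (ENNReal.summable_toReal hfin).congr fun i => ?_
  exact ENNReal.toReal_ofReal (h i).1

lemma interference_pos (hx : IsRegular α x γ) (hP : 0 < P) : 0 < interference P α x γ := by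
  have h := hx.ofReal_interfererTerm
  -- The sequence of points is infinite, so index `nearestBS x + 1` is an interferer. Hence the SINR
  -- denominator is positive even when `σ2 = 0`.
  refine mul_pos hP (hx.summable_interfererTerm.tsum_pos (fun i => (h i).1) (nearestBS x + 1) ?_)
  rw [interfererTerm, if_neg (by omega)]
  have : 0 < ‖x (nearestBS x + 1)‖ := lt_of_lt_of_le hx.servingDist_pos (hx.nearestBS_le _)
  have := hx.gain_pos (nearestBS x + 1)
  positivity

lemma invSinr_pos (hx : IsRegular α x γ) (hP : 0 < P) (hσ2 : 0 ≤ σ2) :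
    0 < invSinr P α σ2 x γ := by
  have h1 := hx.interference_pos hP
  have h2 := Real.rpow_pos_of_pos hx.servingDist_pos α
  unfold invSinr
  positivity

lemma servingDist_sq_le (hx : IsRegular α x γ) :
    (∀ i, servingDist x ^ 2 ≤ ‖x i‖ ^ 2) ∧ ∃ i, servingDist x ^ 2 = ‖x i‖ ^ 2 :=
  ⟨fun i => pow_le_pow_left₀ (norm_nonneg _) (hx.nearestBS_le i) 2, _, rfl⟩

lemma ofReal_invSinr (hx : IsRegular α x γ) (hP : 0 < P) (hσ2 : 0 ≤ σ2) :
    ENNReal.ofReal (invSinr P α σ2 x γ) = invSnr (α / 2) (σ2 / P) (servingDist x ^ 2) x γ := by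
  have h := hx.ofReal_interfererTerm
  have hR := hx.servingDist_pos.le
  have h1 : invSinr P α σ2 x γ = (servingDist x ^ 2) ^ (α / 2) *
      (σ2 / P + ∑' i, interfererTerm α x γ i) := by
    rw [invSinr, interference, ← Real.rpow_natCast_mul hR]
    rw [show ((2 : ℕ) : ℝ) * (α / 2) = α by push_cast; ring]
    field_simp
  rw [h1, invSnr, ENNReal.ofReal_mul (by positivity), ENNReal.ofReal_add (by positivity)
    (tsum_nonneg fun i => (h i).1), ENNReal.ofReal_tsum_of_nonneg (fun i => (h i).1)
    hx.summable_interfererTerm]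
  simp_rw [(h _).2]

lemma nexp_mul_invSnr (hx : IsRegular α x γ) (hP : 0 < P) (hσ2 : 0 ≤ σ2) {θ : ℝ} (hθ : 0 ≤ θ) :
    nexp (ENNReal.ofReal θ * invSnr (α / 2) (σ2 / P) (servingDist x ^ 2) x γ) =
      ENNReal.ofReal (Real.exp (-(θ * invSinr P α σ2 x γ))) := by
  have h := hx.invSinr_pos hP hσ2
  rw [← hx.ofReal_invSinr hP hσ2, ← ENNReal.ofReal_mul hθ, nexp_ofReal (by positivity)]

end IsRegular

end Pathwise

/-! ### Normalized SNR scheduling -/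

lemma integral_id_expMeasure : ∫ x, x ∂(expMeasure 1) = 1 := by
  have := isProbabilityMeasure_expMeasure one_pos
  have hpos : 0 ≤ᵐ[expMeasure 1] fun x => x := ae_pos_expMeasure.mono fun x hx => le_of_lt hx
  rw [integral_eq_lintegral_of_nonneg_ae hpos measurable_id.aestronglyMeasurable,
    lintegral_eq_lintegral_meas_lt _ hpos measurable_id.aemeasurable]
  have h1 : ∀ t ∈ Ioi (0 : ℝ), expMeasure 1 {a | t < a} = ENNReal.ofReal (Real.exp (-t)) := by
    intro t ht
    have ht : 0 < t := ht
    have h2 : {a : ℝ | t < a} = (Iic t)ᶜ := by ext; simp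
    rw [h2, prob_compl_eq_one_sub measurableSet_Iic, ← ofReal_measureReal, ← cdf_eq_real,
      cdf_expMeasure_eq one_pos, if_pos ht.le, one_mul, ← ENNReal.ofReal_one,
      ← ENNReal.ofReal_sub _ (by have : Real.exp (-t) ≤ 1 := Real.exp_le_one_iff.2 (by linarith)
                                 linarith), sub_sub_cancel]
  rw [setLIntegral_congr_fun measurableSet_Ioi h1, ← ofReal_integral_eq_lintegral_ofReal
    (by simpa [IntegrableOn] using integrableOn_exp_mul_Ioi (by norm_num : (-1 : ℝ) < 0) 0)
    (Eventually.of_forall fun t => (Real.exp_pos _).le), integral_exp_neg_Ioi_zero]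
  simp

/-- The SNR is linear in the gain and the mean gain is 1, so power, distance and noise cancel: the
scheduler compares bare gains, and the positions of the other users play no role. -/
lemma normSNR_eq {P α σ2 : ℝ} (hP : 0 < P) (hσ2 : 0 ≤ σ2) {r : ℝ} (hr : 0 < r) (x : ℝ) :
    normSNR P α σ2 x r = x := by
  set c : ℝ := if σ2 = 0 then 1 else σ2 with hc
  have hc0 : 0 < c := by
    rw [hc]
    split_ifs with h
    · exact one_pos
    · exact lt_of_le_of_ne hσ2 (Ne.symm h)
  have h1 : ∀ y, snr P α σ2 y r = y * (P * r ^ (-α) / c) := by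
    intro y
    rw [snr, ← hc]; ring
  have hr' := Real.rpow_pos_of_pos hr (-α)
  rw [normSNR, avgSNR]
  simp_rw [h1]
  rw [integral_mul_const, integral_id_expMeasure]
  field_simp

lemma taggedScheduled_iff {P α σ2 : ℝ} (hP : 0 < P) (hσ2 : 0 ≤ σ2) {h r : ℕ → ℝ}
    (hr : ∀ i, 0 < r i) (n : ℕ) : TaggedScheduled P α σ2 h r n ↔ ∀ i ≤ n, h i ≤ h 0 := by
  unfold TaggedScheduled
  simp_rw [normSNR_eq hP hσ2 (hr _)]
  simp


/-! ### The downlink model: independence, regularity and the Laplace transform of `invSinr`. -/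

section Model

attribute [local irreducible] servingDist interfererTerm interference invSinr

variable {Ω : Type*}
  {lamb lamu P α σ2 : ℝ} {X : ℕ → Ω → Plane} {g h r : ℕ → Ω → ℝ} {N : Ω → ℕ}

lemma scheduledRate_eq (ω : Ω) : scheduledRate P α σ2 X g h N ω =
    Real.log (1 + maxGain (fun i => h i ω) (N ω) /
      invSinr P α σ2 (fun i => X i ω) (fun i => g i ω)) := by
  rw [scheduledRate, sinr_eq_div]

lemma taggedRate_eq (ω : Ω) : taggedRate P α σ2 X g h ω =
    Real.log (1 + h 0 ω / invSinr P α σ2 (fun i => X i ω) (fun i => g i ω)) := by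
  rw [taggedRate, sinr_eq_div]

namespace IsDownlinkModel

variable [MeasurableSpace Ω] {μ : Measure Ω}

lemma ae_servingDist_pos (hmodel : IsDownlinkModel μ lamb lamu X g h r N) :
    ∀ᵐ ω ∂μ, 0 < servingDist (fun i => X i ω) := by
  filter_upwards [hmodel.r_pos 0] with ω hω
  rwa [hmodel.r_tagged] at hω

lemma indepFun_invSinr_gain (hmodel : IsDownlinkModel μ lamb lamu X g h r N) (P α σ2 : ℝ) :
    IndepFun (fun ω => invSinr P α σ2 (fun i => X i ω) (fun i => g i ω)) (fun ω i => h i ω) μ :=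
  hmodel.indep_users.comp (measurable_invSinr P α σ2) measurable_id

lemma indepFun_invSinr_gain_count (hmodel : IsDownlinkModel μ lamb lamu X g h r N) (P α σ2 : ℝ) :
    IndepFun (fun ω => (invSinr P α σ2 (fun i => X i ω) (fun i => g i ω), fun i => h i ω)) N μ := by
  have hm : Measurable fun q : (ℕ → Plane) × (ℕ → ℝ) × (ℕ → ℝ) =>
      (invSinr P α σ2 q.1 q.2.1, q.2.2) :=
    ((measurable_invSinr P α σ2).comp (measurable_fst.prodMk
      (measurable_fst.comp measurable_snd))).prodMk (measurable_snd.comp measurable_snd)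
  exact hmodel.indep_N.comp hm measurable_id

lemma scheduledEvent_ae_eq (hmodel : IsDownlinkModel μ lamb lamu X g h r N) (hP : 0 < P)
    (hσ2 : 0 ≤ σ2) (n : ℕ) :
    scheduledEvent P α σ2 h r N n =ᵐ[μ] {ω | N ω = n ∧ ∀ j ≤ n, h j ω ≤ h 0 ω} := by
  filter_upwards [ae_all_iff.2 hmodel.r_pos] with ω hω
  refine propext ?_
  change (N ω = n ∧ TaggedScheduled P α σ2 (fun i => h i ω) (fun i => r i ω) n) ↔
    (N ω = n ∧ ∀ j ≤ n, h j ω ≤ h 0 ω)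
  rw [taggedScheduled_iff hP hσ2 hω]

lemma measurable_invSinr_model (hmodel : IsDownlinkModel μ lamb lamu X g h r N) (P α σ2 : ℝ) :
    Measurable fun ω => invSinr P α σ2 (fun i => X i ω) (fun i => g i ω) := by
  have h1 : Measurable fun ω => ((fun i => X i ω), (fun i => g i ω)) :=
    (measurable_pi_lambda _ hmodel.ppp.measurable).prodMk
      (measurable_pi_lambda _ hmodel.fading_interf.measurable)
  have h2 := (measurable_invSinr P α σ2).comp h1
  exact h2

variable [IsProbabilityMeasure μ]

lemma ae_isRegular (hmodel : IsDownlinkModel μ lamb lamu X g h r N) (hlamb : 0 < lamb)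
    (hα : 2 < α) : ∀ᵐ ω ∂μ, IsRegular α (fun i => X i ω) (fun i => g i ω) := by
  filter_upwards [hmodel.ppp.ae_finite, hmodel.ppp.ae_injective_norm hlamb.le,
    hmodel.fading_interf.ae_pos, hmodel.ae_servingDist_pos,
    hmodel.ppp.ae_tsum_lossBeyond_ne_top hlamb.le hmodel.fading_interf
      hmodel.indep_interf (by linarith : 1 < α / 2)] with ω h1 h2 h3 h4 h5
  have h6 := exists_isLeast_norm h1
  have h7 := h5 (servingDist (fun i => X i ω) ^ 2)
  exact ⟨h6, h2, h3, h4, h7⟩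

/-- Supplies the hypothesis `hlap` of `IsIIDExp.lintegral_log_maxGain_eq`; here `v` stands for the
squared serving distance. -/
lemma lintegral_exp_invSinr (hmodel : IsDownlinkModel μ lamb lamu X g h r N) (hlamb : 0 < lamb)
    (hP : 0 < P) (hα : 2 < α) (hσ2 : 0 ≤ σ2) {θ : ℝ} (hθ : 0 < θ) :
    ∫⁻ ω, ENNReal.ofReal
        (Real.exp (-(θ * invSinr P α σ2 (fun i => X i ω) (fun i => g i ω)))) ∂μ =
      ∫⁻ v in Ioi 0, ENNReal.ofReal (Real.pi * lamb * rateExp lamb P α σ2 θ v) := by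
  have hreg := hmodel.ae_isRegular hlamb hα
  have hVm : Measurable fun ω => servingDist (fun i => X i ω) ^ 2 := by
    have h := measurable_servingDist.comp (measurable_pi_lambda _ hmodel.ppp.measurable)
    exact h.pow_const 2
  have hV : ∀ᵐ ω ∂μ, (∀ i, servingDist (fun i => X i ω) ^ 2 ≤ ‖X i ω‖ ^ 2) ∧
      ∃ i, servingDist (fun i => X i ω) ^ 2 = ‖X i ω‖ ^ 2 :=
    hreg.mono fun ω hω => hω.servingDist_sq_le
  have h1 := hmodel.ppp.lintegral_invSnr hlamb hmodel.fading_interf hmodel.indep_interf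
    (by linarith : 1 < α / 2) (σ2 / P) θ hVm hV
  have h2 := lintegral_congr_ae (hreg.mono fun ω hω => hω.nexp_mul_invSnr hP hσ2 hθ.le)
  rw [← h2, h1]
  exact setLIntegral_congr_fun measurableSet_Ioi fun v hv =>
    ofReal_mul_cellWeight hα hlamb (by positivity) hθ hv

lemma measure_count_eq (hmodel : IsDownlinkModel μ lamb lamu X g h r N) (n : ℕ) :
    μ {ω | N ω = n} = ENNReal.ofReal (pmfN lamb lamu n) := by
  rw [← hmodel.law_N n, ofReal_measureReal]

end IsDownlinkModel

end Model

end Cellular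

/-! ### Assembly of the theorem. -/

theorem proposition2 {Ω : Type*} [MeasurableSpace Ω] (μ : Measure Ω) [IsProbabilityMeasure μ]
    (lamb lamu P α σ2 : ℝ) (hlamb : 0 < lamb) (hlamu : 0 < lamu) (hP : 0 < P) (hα : 2 < α)
    (hσ2 : 0 ≤ σ2)
    (X : ℕ → Ω → Cellular.Plane) (g h r : ℕ → Ω → ℝ) (N : Ω → ℕ)
    (hmodel : Cellular.IsDownlinkModel μ lamb lamu X g h r N) :
    -- the interference is almost surely a convergent series
    (∀ᵐ ω ∂μ, Summable
      (Cellular.interfererTerm α (fun i => X i ω) (fun i => g i ω))) ∧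
    -- the rate has finite mean and the double integrals converge absolutely
    Integrable (Cellular.scheduledRate P α σ2 X g h N) μ ∧
    (∀ n : ℕ, IntegrableOn (fun p : ℝ × ℝ => Cellular.rateIntegrand lamb P α σ2 n p.1 p.2)
      (Ioi 0 ×ˢ Ioi 0)) ∧
    -- the formula for the average rate
    HasSum (fun n : ℕ => Real.pi * lamb * (Cellular.pmfN lamb lamu n *
        ∫ v in Ioi (0 : ℝ), ∫ t in Ioi (0 : ℝ), Cellular.rateIntegrand lamb P α σ2 n v t))
      (Cellular.avgRate μ P α σ2 X g h N) ∧
    -- the average rate is the mean over `N` of the conditional mean rate of the tagged user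
    -- given that it is scheduled
    (∀ n : ℕ, μ (Cellular.scheduledEvent P α σ2 h r N n) ≠ 0 ∧
      Integrable (Cellular.taggedRate P α σ2 X g h)
        (cond μ (Cellular.scheduledEvent P α σ2 h r N n))) ∧
    HasSum (fun n : ℕ => Cellular.pmfN lamb lamu n *
        ∫ ω, Cellular.taggedRate P α σ2 X g h ω
          ∂(cond μ (Cellular.scheduledEvent P α σ2 h r N n)))
      (Cellular.avgRate μ P α σ2 X g h N) := by
  open Cellular in
  have hg := hmodel.fading_interf
  have hh := hmodel.fading_users
  set W : Ω → ℝ := fun ω => invSinr P α σ2 (fun i => X i ω) (fun i => g i ω) with hWdef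
  have hW : Measurable W := hmodel.measurable_invSinr_model P α σ2
  have hW0 : ∀ᵐ ω ∂μ, 0 < W ω :=
    (hmodel.ae_isRegular hlamb hα).mono fun ω hω => hω.invSinr_pos hP hσ2
  have hWh : IndepFun W (fun ω i => h i ω) μ := hmodel.indepFun_invSinr_gain P α σ2
  have hWN : IndepFun (fun ω => (W ω, fun i => h i ω)) N μ :=
    hmodel.indepFun_invSinr_gain_count P α σ2
  have hh0 : ∀ᵐ ω ∂μ, 0 < h 0 ω := hh.ae_pos.mono fun ω hω => hω 0
  -- the mean rate with the largest of `n + 1` gains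
  set E : ℕ → ℝ≥0∞ := fun n =>
    ∫⁻ ω, ENNReal.ofReal (Real.log (1 + maxGain (fun i => h i ω) n / W ω)) ∂μ with hE
  have hEeq := fun n => hh.lintegral_log_maxGain_eq hW hW0 hWh hlamb hP hα hσ2
    (fun θ hθ => hmodel.lintegral_exp_invSinr hlamb hP hα hσ2 hθ) n
  have hEreal : ∀ n, (E n).toReal = Real.pi * lamb *
      ∫ v in Ioi (0 : ℝ), ∫ t in Ioi (0 : ℝ), rateIntegrand lamb P α σ2 n v t := by
    intro n
    simp only [hE]
    rw [(hEeq n).2, ENNReal.toReal_ofReal (hEeq n).1]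
  have hEtop : ∀ n, E n ≠ ⊤ := by
    intro n
    simp only [hE]
    rw [(hEeq n).2]
    exact ENNReal.ofReal_ne_top
  -- the mean rate of the scheduled user
  have htotal : ∫⁻ ω, ENNReal.ofReal (scheduledRate P α σ2 X g h N ω) ∂μ =
      ∑' n, ENNReal.ofReal (pmfN lamb lamu n) * E n := by
    have hF : ∀ n : ℕ, Measurable fun q : ℝ × (ℕ → ℝ) =>
        ENNReal.ofReal (Real.log (1 + maxGain q.2 n / q.1)) := by
      intro n
      have hM : Measurable fun q : ℝ × (ℕ → ℝ) => maxGain q.2 n :=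
        (measurable_maxGain n).comp measurable_snd
      fun_prop
    have h1 := lintegral_comp_nat_of_indepFun hWN (hW.prodMk hh.measurable_seq)
      hmodel.measurable_N hF
    simp_rw [hmodel.measure_count_eq] at h1
    simp_rw [scheduledRate_eq]
    exact h1
  have hsumtop : ∑' n, ENNReal.ofReal (pmfN lamb lamu n) * E n ≠ ⊤ := by
    -- Comparison with the single-user rate `E 0` leaves the mean of `N + 1`, which is finite.
    have hle : ∀ n : ℕ, ENNReal.ofReal (pmfN lamb lamu n) * E n ≤
        ENNReal.ofReal (((n : ℝ) + 1) * pmfN lamb lamu n) * E 0 := by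
      intro n
      rw [mul_comm ((n : ℝ) + 1), ENNReal.ofReal_mul (pmfN_pos hlamb hlamu n).le, mul_assoc]
      gcongr
      exact hh.lintegral_log_maxGain_le hW hW0 hWh n
    refine ne_top_of_le_ne_top ?_ (ENNReal.tsum_le_tsum hle)
    rw [ENNReal.tsum_mul_right]
    exact ENNReal.mul_ne_top (summable_succ_mul_pmfN hlamb hlamu).tsum_ofReal_ne_top (hEtop 0)
  have hMm : Measurable fun ω => maxGain (fun i => h i ω) (N ω) := by
    have h1 : Measurable fun q : (ℕ → ℝ) × ℕ => maxGain q.1 q.2 :=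
      measurable_from_prod_countable_left measurable_maxGain
    exact h1.comp (hh.measurable_seq.prodMk hmodel.measurable_N)
  have hSm : Measurable (scheduledRate P α σ2 X g h N) := by
    have h1 : scheduledRate P α σ2 X g h N =
        fun ω => Real.log (1 + maxGain (fun i => h i ω) (N ω) / W ω) :=
      funext fun ω => scheduledRate_eq ω
    rw [h1]
    fun_prop
  have hS0 : 0 ≤ᵐ[μ] scheduledRate P α σ2 X g h N := by
    filter_upwards [hW0, hh0] with ω h1 h2
    have h3 : 0 < maxGain (fun i => h i ω) (N ω) :=
      h2.trans_le (le_maxGain (x := fun i => h i ω) (Nat.zero_le _))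
    rw [scheduledRate_eq]
    refine Real.log_nonneg ?_
    have : 0 < maxGain (fun i => h i ω) (N ω) / W ω := div_pos h3 h1
    linarith
  have havg : avgRate μ P α σ2 X g h N =
      ∑' n, (ENNReal.ofReal (pmfN lamb lamu n) * E n).toReal := by
    rw [avgRate, integral_eq_lintegral_of_nonneg_ae hS0 hSm.aestronglyMeasurable, htotal,
      ENNReal.tsum_toReal_eq fun n => ENNReal.mul_ne_top ENNReal.ofReal_ne_top (hEtop n)]
  have hsum : HasSum (fun n => pmfN lamb lamu n * (E n).toReal) (avgRate μ P α σ2 X g h N) := by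
    rw [havg]
    have h1 := ENNReal.hasSum_toReal hsumtop
    have h2 : ∀ n, (ENNReal.ofReal (pmfN lamb lamu n) * E n).toReal =
        pmfN lamb lamu n * (E n).toReal := fun n => by
      rw [ENNReal.toReal_mul, ENNReal.toReal_ofReal (pmfN_pos hlamb hlamu n).le]
    simp_rw [h2] at h1 ⊢
    exact h1
  -- the conditional mean rates of the tagged user
  have hTm : Measurable (taggedRate P α σ2 X g h) := by
    have h1 : taggedRate P α σ2 X g h = fun ω => Real.log (1 + h 0 ω / W ω) :=
      funext fun ω => taggedRate_eq ω
    have h2 := hh.measurable 0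
    rw [h1]
    fun_prop
  have hT0 : 0 ≤ᵐ[μ] taggedRate P α σ2 X g h := by
    filter_upwards [hW0, hh0] with ω h1 h2
    rw [taggedRate_eq]
    refine Real.log_nonneg ?_
    have : 0 < h 0 ω / W ω := div_pos h2 h1
    linarith
  have hcond := fun n => hh.lintegral_cond_top hW hWh hmodel.measurable_N hWN (n := n) (by
    rw [hmodel.measure_count_eq]
    simpa using pmfN_pos hlamb hlamu n)
  have hae := fun n => hmodel.scheduledEvent_ae_eq (α := α) hP hσ2 n
  have hcond_eq : ∀ n, ProbabilityTheory.cond μ (scheduledEvent P α σ2 h r N n) =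
      ProbabilityTheory.cond μ {ω | N ω = n ∧ ∀ j ≤ n, h j ω ≤ h 0 ω} := by
    intro n
    rw [ProbabilityTheory.cond, ProbabilityTheory.cond, measure_congr (hae n),
      Measure.restrict_congr_set (hae n)]
  -- The conditional means are the same numbers `E n` as in the unconditional formula, so both
  -- series reduce to `hsum`.
  have hTE : ∀ n, ∫⁻ ω, ENNReal.ofReal (taggedRate P α σ2 X g h ω)
      ∂(ProbabilityTheory.cond μ (scheduledEvent P α σ2 h r N n)) = E n := by
    intro n
    rw [hcond_eq]
    simp_rw [taggedRate_eq]
    exact (hcond n).2 (fun x w => ENNReal.ofReal (Real.log (1 + x / w)))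
      (by unfold Function.uncurry; fun_prop)
  have hT0' : ∀ n, 0 ≤ᵐ[ProbabilityTheory.cond μ (scheduledEvent P α σ2 h r N n)]
      taggedRate P α σ2 X g h := fun n => cond_absolutelyContinuous.ae_le hT0
  refine ⟨(hmodel.ae_isRegular hlamb hα).mono fun ω hω => hω.summable_interfererTerm, ?_,
    integrableOn_rateIntegrand hlamb hP hα hσ2, ?_, ?_, ?_⟩
  · rw [← lintegral_ofReal_ne_top_iff_integrable hSm.aestronglyMeasurable hS0, htotal]
    exact hsumtop
  · convert hsum using 2 with n
    rw [hEreal]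
    ring
  · intro n
    refine ⟨?_, ?_⟩
    · rw [measure_congr (hae n)]
      exact (hcond n).1
    · rw [← lintegral_ofReal_ne_top_iff_integrable hTm.aestronglyMeasurable (hT0' n), hTE]
      exact hEtop n
  · convert hsum using 2 with n
    rw [integral_eq_lintegral_of_nonneg_ae (hT0' n) hTm.aestronglyMeasurable, hTE]
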